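/- Let $A$ be a finite set (alphabet), $n\ge 1$ an integer, and let $\Pr(A^n)$ denote the set of probability measures on $A^n$. Let $d_n(\mathbf a,\mathbf a')=\frac1n|\{i: a_i\ne a_i'\}|$ be the normalized Hamming metric on $A^n$, and for $\mu,\nu\in\Pr(A^n)$ let $$\overline{d_n}(\mu,\nu)=\inf_\lambda\int d_n(\mathbf a,\mathbf a')\,\lambda(\mathrm d\mathbf a,\mathrm d\mathbf a'),$$ where the infimum runs over all couplings $\lambda$ of $\mu$ and $\nu$. For $\kappa,r>0$ we say that $\mu\in\Pr(A^n)$ satisfies $\mathrm T(\kappa,r)$ if $$\overline{d_n}(\nu,\mu)\le\frac1\kappa\,\mathrm D(\nu\,\|\,\mu)+r\qquad\text{for all }\nu\in\Pr(A^n),$$ where $\mathrm D(\nu\,\|\,\mu)\in[0,\infty]$ is the Kullback--Leibler divergence. The dual total correlation of $\mu\in\Pr(A^n)$ is $$\mathrm{DTC}(\mu)=\mathrm H(\xi)-\sum_{i=1}^n\mathrm H(\xi_i\mid \xi_{[n]\setminus i}),$$ where $\xi=(\xi_1,\dots,\xi_n)$ is a random variable with law $\mu$, $\xi_{[n]\setminus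 i}=(\xi_j)_{j\ne i}$, and $\mathrm H$ denotes (conditional) Shannon entropy with natural logarithms. **Theorem 6.1.** For any $\varepsilon,r>0$ there exists $c>0$, depending only on $\varepsilon$ and $r$, such that the following holds for every finite alphabet $A$ and every integer $n\ge1$. Any $\mu\in\Pr(A^n)$ can be written as a mixture $$\mu=p_1\mu_1+\dots+p_m\mu_m,\qquad m\ge1,\quad p_1,\dots,p_m\ge0,\quad p_1+\dots+p_m=1,\quad \mu_1,\dots,\mu_m\in\Pr(A^n),$$ so that (a) $m\le c\exp(c\cdot\mathrm{DTC}(\mu))$, (b) $p_1<\varepsilon$, and (c) the measure $\mu_j$ satisfies $\mathrm T(rn/600,r)$ for every $j=2,3,\dots,m$. -/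

import Mathlib

open MeasureTheory ProbabilityTheory

universe u

noncomputable section

/-- Shannon entropy (natural logarithm) of a probability distribution on a finite set. -/
def shannonEntropy {X : Type*} [Fintype X] [MeasurableSpace X] (μ : Measure X) : ℝ :=
  ∑ x : X, Real.negMulLog (μ.real {x})

/-- Conditional Shannon entropy `H(ξ | ζ)` of finite-valued random variables on `(Ω, P)`: the average
over the values `z` of `ζ` of the entropy of the conditional distribution of `ξ` given `ζ = z`.
Values `z` of probability zero have weight zero. -/
def condShannonEntropy {Ω X Z : Type*} [MeasurableSpace Ω] [Fintype X] [MeasurableSpace X]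
    [Fintype Z] (P : Measure Ω) (ξ : Ω → X) (ζ : Ω → Z) : ℝ :=
  ∑ z : Z, P.real (ζ ⁻¹' {z}) * shannonEntropy ((P[|ζ ⁻¹' {z}]).map ξ)

/-- Dual total correlation of a probability distribution `μ` on `A^n`:
`H(ξ) - ∑ i, H(ξ_i | ξ_{[n] \ i})`, where `ξ = (ξ_1, …, ξ_n)` has law `μ`. -/
def dualTotalCorrelation {A : Type*} [Fintype A] [MeasurableSpace A] {n : ℕ}
    (μ : Measure (Fin n → A)) : ℝ :=
  shannonEntropy μ -
    ∑ i : Fin n, condShannonEntropy μ (fun x : Fin n → A => x i)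
      (fun (x : Fin n → A) (j : {j : Fin n // j ≠ i}) => x j)

/-- The normalized Hamming metric on `A^n`. -/
def normHamming {A : Type*} [DecidableEq A] {n : ℕ} (x y : Fin n → A) : ℝ :=
  (hammingDist x y : ℝ) / (n : ℝ)

/-- `γ` is a coupling of `μ` and `ν`. -/
def IsCouplingOf {K : Type*} [MeasurableSpace K] (γ : Measure (K × K)) (μ ν : Measure K) : Prop :=
  γ.map Prod.fst = μ ∧ γ.map Prod.snd = ν

/-- The transportation metric associated to a metric `d`: the infimum of `∫ d(x, y) dγ` over all
couplings `γ` of `μ` and `ν`. -/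
def transportDist {K : Type*} [MeasurableSpace K] (d : K → K → ℝ) (μ ν : Measure K) : ℝ :=
  sInf {t : ℝ | ∃ γ : Measure (K × K), IsCouplingOf γ μ ν ∧ t = ∫ q, d q.1 q.2 ∂γ}

/-- The inequality `T(κ, r)` for `(K, d, μ)`: every probability measure `ν` satisfies
`transportDist d ν μ ≤ D(ν ‖ μ) / κ + r`. It is stated in `[0, ∞]`, because the Kullback--Leibler
divergence `D(ν ‖ μ)` is infinite unless `ν` is absolutely continuous with respect to `μ`. -/
def TInequality {K : Type*} [MeasurableSpace K] (d : K → K → ℝ) (μ : Measure K) (κ r : ℝ) : Prop :=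
  ∀ ν : Measure K, IsProbabilityMeasure ν →
    ENNReal.ofReal (transportDist d ν μ) ≤
      InformationTheory.klDiv ν μ / ENNReal.ofReal κ + ENNReal.ofReal r

end

/-! Weight functions are left unnormalised, so that entropies are homogeneous of degree one. Among
the decompositions of the weights w of μ into nonnegative pieces, minimise the total of `pot` = H/2
− ∑ i, H(ξ_i | the other coordinates). Two things follow. A small multiple of any u split off from a
minimising piece q cannot lower the total. The first-order condition is D(u‖q) ≤ 2 ∑ i, D_i(u‖q),
where D_i is the divergence conditional on the coordinates other than i
(`condKL_le_of_forall_split`): entropy tensorizes approximately for q. Comparing the minimum with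
the undecomposed w, and bounding the potential of each piece below by −H/2 through Han's inequality
(`sum_condEnt_drop_le`), shows that the mixture has mutual information at most 2 DTC(μ)
(`exists_tensorizing_mixture`).

Applied to exponential tilts of a Lipschitz function, tensorization becomes Herbst's differential
inequality, hence a sub-Gaussian bound at scale 1/n (`sum_mul_exp_le`). The Gibbs inequality and
Kantorovich duality turn exponential moments into transport (`tInequality_of_exp_moment`).

The minimiser may have far too many pieces. Since its information is at most I = 2 DTC(μ), about
exp(I/η)/η² sampled pieces with truncated densities already cover w up to mass O(η)
(`exists_subpieces`). They are trimmed so that their sum stays below w; those retaining almost all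
their mass have density at most 1 + δ relative to a tensorizing q, which preserves the exponential
moment bound (`exp_moment_of_le`). Everything left over becomes the exceptional first term. -/

namespace FiniteEntropy

open Real Finset

/-! ### Entropy and divergence of unnormalised weights -/

section Basic

variable {X Z : Type*} [Fintype X]

open scoped Classical in
/-- The image of a weight function under a map of finite types. -/
noncomputable def push (g : X → Z) (u : X → ℝ) (z : Z) : ℝ := ∑ x with g x = z, u x

/-- The entropy sum of a weight function. -/
noncomputable def ent (u : X → ℝ) : ℝ := ∑ x, negMulLog (u x)

/-- The conditional entropy of a weight function given a map, scaled by the total weight. -/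
noncomputable def condEnt [Fintype Z] (g : X → Z) (u : X → ℝ) : ℝ := ent u - ent (push g u)

/-- The conditional divergence of two weight functions given a map. -/
noncomputable def condKL (g : X → Z) (u w : X → ℝ) : ℝ :=
  ∑ x, u x * (log (u x) - log (w x) - (log (push g u (g x)) - log (push g w (g x))))

/-- The map that remembers nothing. -/
def triv (_ : X) : Unit := ()

lemma sum_push_mul [Fintype Z] (g : X → Z) (u : X → ℝ) (F : Z → ℝ) :
    ∑ z, push g u z * F z = ∑ x, u x * F (g x) := by
  classical
  rw [← Finset.sum_fiberwise (s := univ) (g := g) (f := fun x => u x * F (g x))]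
  refine Finset.sum_congr rfl fun z _ => ?_
  rw [push, Finset.sum_mul]
  refine Finset.sum_congr (by congr) fun x hx => ?_
  rw [(Finset.mem_filter.1 hx).2]

lemma sum_push [Fintype Z] (g : X → Z) (u : X → ℝ) : ∑ z, push g u z = ∑ x, u x := by
  simpa using sum_push_mul g u 1

lemma le_push {u : X → ℝ} (hu : 0 ≤ u) (g : X → Z) (x : X) : u x ≤ push g u (g x) := by
  classical
  exact Finset.single_le_sum (f := u) (fun y _ => hu y) (by simp)

lemma push_triv (u : X → ℝ) (z : Unit) : push triv u z = ∑ x, u x := by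
  simp [push, triv]

lemma push_smul (g : X → Z) (s : ℝ) (u : X → ℝ) : push g (s • u) = s • push g u := by
  ext z; simp [push, Finset.mul_sum]

lemma push_sub_smul (g : X → Z) (w u : X → ℝ) (s : ℝ) (z : Z) :
    push g (w - s • u) z = push g w z - s * push g u z := by
  simp [push, Finset.mul_sum, Finset.sum_sub_distrib]

lemma push_eq_zero {w u : X → ℝ} (hw : 0 ≤ w) (h : ∀ x, w x = 0 → u x = 0) (g : X → Z) (z : Z)
    (hz : push g w z = 0) : push g u z = 0 := by
  classical
  have := (Finset.sum_eq_zero_iff_of_nonneg (fun x _ => hw x)).1 hz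
  exact Finset.sum_eq_zero fun x hx => h x (this x hx)

lemma ent_push [Fintype Z] (g : X → Z) (u : X → ℝ) :
    ent (push g u) = -∑ x, u x * log (push g u (g x)) := by
  rw [← sum_push_mul g u (fun z => log (push g u z)), ent, ← Finset.sum_neg_distrib]
  simp [negMulLog]

lemma condEnt_eq [Fintype Z] (g : X → Z) (u : X → ℝ) :
    condEnt g u = ∑ x, u x * (log (push g u (g x)) - log (u x)) := by
  rw [condEnt, ent_push, ent, sub_neg_eq_add, ← Finset.sum_add_distrib]
  exact Finset.sum_congr rfl fun x _ => by rw [negMulLog]; ring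

lemma ent_smul (s : ℝ) (u : X → ℝ) : ent (s • u) = s * ent u + negMulLog s * ∑ x, u x := by
  simp only [ent, Pi.smul_apply, smul_eq_mul, negMulLog_mul, Finset.sum_add_distrib,
    Finset.mul_sum]
  rw [add_comm]
  congr 1
  exact Finset.sum_congr rfl fun x _ => mul_comm _ _

lemma condEnt_smul [Fintype Z] (g : X → Z) (s : ℝ) (u : X → ℝ) : condEnt g (s • u) = s * condEnt g u := by
  rw [condEnt, push_smul, ent_smul, ent_smul, sum_push, condEnt]; ring

lemma continuous_ent : Continuous (ent : (X → ℝ) → ℝ) :=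
  continuous_finsetSum _ fun x _ => continuous_negMulLog.comp (continuous_apply x)

lemma continuous_push (g : X → Z) : Continuous (push g : (X → ℝ) → Z → ℝ) :=
  continuous_pi fun _ => continuous_finsetSum _ fun x _ => continuous_apply x

lemma continuous_condEnt [Fintype Z] (g : X → Z) : Continuous (condEnt g : (X → ℝ) → ℝ) :=
  continuous_ent.sub (continuous_ent.comp (continuous_push g))

/-- The singularity of the logarithm at a = 0 does no harm: there b = 0 as well, and the function is
constant. -/
lemma hasDerivAt_negMulLog_sub {a b : ℝ} (h : a = 0 → b = 0) :
    HasDerivAt (fun s : ℝ => negMulLog (a - s * b)) (b * (log a + 1)) 0 := by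
  by_cases ha : a = 0
  · simpa [ha, h ha] using hasDerivAt_const (0 : ℝ) (0 : ℝ)
  · have h1 : HasDerivAt (fun s : ℝ => a - s * b) (-b) 0 := by
      simpa using ((hasDerivAt_id (0 : ℝ)).mul_const b).const_sub a
    have h2 : HasDerivAt negMulLog (-log a - 1) (a - 0 * b) := by
      simpa using hasDerivAt_negMulLog ha
    refine (h2.comp (0 : ℝ) h1).congr_deriv ?_
    ring

lemma hasDerivAt_ent {w u : X → ℝ} (h : ∀ x, w x = 0 → u x = 0) :
    HasDerivAt (fun s : ℝ => ent (w - s • u)) (∑ x, u x * (log (w x) + 1)) 0 :=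
  HasDerivAt.fun_sum fun x _ => hasDerivAt_negMulLog_sub (h x)

/-- Differentiating an entropy produces a cross-entropy, which is the sum of a divergence and an
entropy. -/
lemma hasDerivAt_condEnt [Fintype Z] {w u : X → ℝ} (hw : 0 ≤ w) (h : ∀ x, w x = 0 → u x = 0) (g : X → Z) :
    HasDerivAt (fun s : ℝ => condEnt g (w - s • u)) (-condKL g u w - condEnt g u) 0 := by
  have h1 := hasDerivAt_ent h
  have h2 := hasDerivAt_ent (push_eq_zero hw h g)
  have h3 : ∀ s : ℝ, push g (w - s • u) = push g w - s • push g u := fun s => by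
    ext z; simp [push_sub_smul]
  simp only [condEnt, h3]
  refine (h1.sub h2).congr_deriv ?_
  rw [sum_push_mul g u (fun z => log (push g w z) + 1), ← condEnt, condEnt_eq, condKL,
    ← Finset.sum_neg_distrib, ← Finset.sum_sub_distrib, ← Finset.sum_sub_distrib]
  exact Finset.sum_congr rfl fun x _ => by ring

end Basic

/-! ### Submodularity of entropy and Han's inequality -/

section Han

variable {I A : Type*} [Fintype I] [DecidableEq I] [Fintype A]

open scoped Classical in
/-- The marginal on the coordinates in `S`, as a function of all coordinates. -/
noncomputable def marg (S : Finset I) (u : (I → A) → ℝ) (x : I → A) : ℝ :=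
  ∑ y with ∀ j ∈ S, y j = x j, u y

/-- Forget the coordinate `i`. -/
def drop (i : I) (x : I → A) (j : {j : I // j ≠ i}) : A := x j

variable {u : (I → A) → ℝ}

lemma marg_nonneg (hu : 0 ≤ u) (S : Finset I) (x : I → A) : 0 ≤ marg S u x :=
  Finset.sum_nonneg fun y _ => hu y

lemma le_marg (hu : 0 ≤ u) (S : Finset I) (x : I → A) : u x ≤ marg S u x := by
  classical
  exact Finset.single_le_sum (f := u) (fun y _ => hu y) (by simp)

lemma marg_congr (S : Finset I) {x y : I → A} (h : ∀ j ∈ S, x j = y j) :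
    marg S u x = marg S u y := by
  classical
  refine Finset.sum_congr (Finset.filter_congr fun v _ => ?_) fun _ _ => rfl
  exact forall₂_congr fun j hj => by rw [h j hj]

lemma marg_empty (x : I → A) : marg ∅ u x = ∑ y, u y := by simp [marg]

lemma marg_univ (x : I → A) : marg univ u x = u x := by
  classical
  simp [marg, ← funext_iff, Finset.filter_eq']

lemma marg_compl (i : I) (x : I → A) :
    marg {i}ᶜ u x = push (drop i) u (drop i x) := by
  classical
  refine Finset.sum_congr ?_ fun _ _ => rfl
  ext v
  simp [drop, funext_iff]

lemma sum_marg_insert {S : Finset I} {i : I} (hi : i ∉ S) (y : I → A) :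
    marg S u y = ∑ a, marg (insert i S) u (Function.update y i a) := by
  classical
  simp only [marg, Finset.sum_filter]
  rw [Finset.sum_comm]
  refine Finset.sum_congr rfl fun v _ => ?_
  have h : ∀ a, (∀ j ∈ insert i S, v j = Function.update y i a j) ↔
      v i = a ∧ ∀ j ∈ S, v j = y j := fun a => by
    rw [Finset.forall_mem_insert, Function.update_self]
    refine and_congr_right fun _ => forall₂_congr fun j hj => ?_
    rw [Function.update_of_ne (ne_of_mem_of_not_mem hj hi)]
  simp only [h, ite_and]
  simp

/-- For fixed y, summing over the i-th coordinate the conditional law of that coordinate given S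
yields one, or zero where the denominator vanishes; hence only an inequality. -/
lemma sum_marg_mul_div_le (hu : 0 ≤ u) {S : Finset I} {i : I} (hi : i ∉ S) :
    ∑ x, marg (insert i S) u x * marg {i}ᶜ u x / marg S u x ≤ ∑ x, u x := by
  classical
  have h1 : ∑ x, marg (insert i S) u x * marg {i}ᶜ u x / marg S u x =
      ∑ y, ∑ x with ∀ j ∈ ({i}ᶜ : Finset I), y j = x j,
        u y * (marg (insert i S) u x / marg S u x) := by
    simp only [Finset.sum_filter]
    rw [Finset.sum_comm]
    refine Finset.sum_congr rfl fun x _ => ?_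
    rw [← Finset.sum_filter, ← Finset.sum_mul, mul_div_right_comm, mul_comm]
    rfl
  have h2 : ∀ y, ∑ x with ∀ j ∈ ({i}ᶜ : Finset I), y j = x j,
      u y * (marg (insert i S) u x / marg S u x) = u y * (marg S u y / marg S u y) := fun y => by
    rw [← Finset.mul_sum]
    congr 1
    nth_rw 1 [sum_marg_insert hi]
    rw [Finset.sum_div]
    refine Finset.sum_bij' (fun x _ => x i) (fun a _ => Function.update y i a) (by simp)
      (fun a _ => ?_) (fun x hx => ?_) (by simp) (fun x hx => ?_)
    · simp only [mem_filter, mem_univ, true_and, mem_compl, mem_singleton]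
      intro j hj; rw [Function.update_of_ne hj]
    · simp only [mem_filter, mem_univ, true_and, mem_compl, mem_singleton] at hx
      ext j
      by_cases hj : j = i
      · subst hj; simp
      · rw [Function.update_of_ne hj, hx j hj]
    · simp only [mem_filter, mem_univ, true_and, mem_compl, mem_singleton] at hx
      congr 1
      · congr 1
        ext j
        by_cases hj : j = i
        · subst hj; simp
        · rw [Function.update_of_ne hj, hx j hj]
      · exact marg_congr S fun j hj => (hx j (ne_of_mem_of_not_mem hj hi)).symm
  rw [h1]
  refine Finset.sum_le_sum fun y _ => ?_
  rw [h2]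
  exact mul_le_of_le_one_right (hu y) (div_self_le_one _)

/-- The entropy of the coordinates in `S`. -/
noncomputable def margEnt (S : Finset I) (u : (I → A) → ℝ) : ℝ := -∑ x, u x * log (marg S u x)

/-- Conditioning on more coordinates lowers entropy. The difference is a conditional mutual
information, bounded below by log t ≤ t − 1 with t the ratio of the conditionally independent law to
u. -/
lemma margEnt_submodular (hu : 0 ≤ u) {S : Finset I} {i : I} (hi : i ∉ S) :
    margEnt univ u - margEnt {i}ᶜ u ≤ margEnt (insert i S) u - margEnt S u := by
  have key : ∑ x, (u x - marg (insert i S) u x * marg {i}ᶜ u x / marg S u x) ≤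
      ∑ x, u x * (log (u x) + log (marg S u x) - log (marg (insert i S) u x)
        - log (marg {i}ᶜ u x)) := by
    refine Finset.sum_le_sum fun x _ => ?_
    have hb := marg_nonneg hu (insert i S) x
    have hc := marg_nonneg hu {i}ᶜ x
    have ha := marg_nonneg hu S x
    rcases (hu x).eq_or_lt with h0 | h0
    · simp only [Pi.zero_apply] at h0
      rw [← h0]
      have := div_nonneg (mul_nonneg hb hc) ha
      linarith
    · simp only [Pi.zero_apply] at h0
      have ha' := h0.trans_le (le_marg hu S x)
      have hb' := h0.trans_le (le_marg hu (insert i S) x)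
      have hc' := h0.trans_le (le_marg hu {i}ᶜ x)
      have h := log_le_sub_one_of_pos
        (div_pos (mul_pos hb' hc') (mul_pos h0 ha'))
      rw [log_div (mul_pos hb' hc').ne' (mul_pos h0 ha').ne', log_mul hb'.ne' hc'.ne',
        log_mul h0.ne' ha'.ne'] at h
      have h' := mul_le_mul_of_nonneg_left h h0.le
      have e : u x * (marg (insert i S) u x * marg {i}ᶜ u x / (u x * marg S u x) - 1) =
          marg (insert i S) u x * marg {i}ᶜ u x / marg S u x - u x := by
        field_simp
      rw [e] at h'
      linarith
  rw [Finset.sum_sub_distrib] at key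
  have h2 := sum_marg_mul_div_le hu hi
  simp only [margEnt, marg_univ]
  have e : ∑ x, u x * (log (u x) + log (marg S u x) - log (marg (insert i S) u x)
        - log (marg {i}ᶜ u x)) = ∑ x, u x * log (u x) + ∑ x, u x * log (marg S u x)
        - ∑ x, u x * log (marg (insert i S) u x) - ∑ x, u x * log (marg {i}ᶜ u x) := by
    rw [← Finset.sum_add_distrib, ← Finset.sum_sub_distrib, ← Finset.sum_sub_distrib]
    exact Finset.sum_congr rfl fun x _ => by ring
  linarith

/-- Han's inequality: the dual total correlation is nonnegative. -/
theorem sum_condEnt_drop_le (hu : 0 ≤ u) :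
    ∑ i : I, condEnt (drop i) u ≤ condEnt triv u := by
  classical
  -- Adding coordinates one at a time telescopes the right-hand side, as in the chain rule.
  have h : ∀ S : Finset I, ∑ i ∈ S, (margEnt univ u - margEnt {i}ᶜ u) ≤
      margEnt S u - margEnt ∅ u := fun S => by
    induction S using Finset.induction_on with
    | empty => simp
    | insert i S hi ih =>
      rw [Finset.sum_insert hi]
      linarith [margEnt_submodular hu hi]
  have huniv : margEnt univ u = ent u := by
    simp [margEnt, marg_univ, ent, negMulLog]
  have hc : ∀ i, margEnt {i}ᶜ u = ent (push (drop i) u) := fun i => by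
    rw [ent_push]; simp only [margEnt, marg_compl]
  have he : margEnt ∅ u = ent (push triv u) := by
    rw [ent_push]; simp only [margEnt, marg_empty, push_triv]
  simpa only [huniv, hc, he, condEnt] using h univ

end Han

/-! ### Optimal decompositions and approximate tensorization -/

section Decomposition

variable {X ι : Type*} [Fintype X] [Fintype ι] {Z : ι → Type*} [∀ i, Fintype (Z i)]
  (g : ∀ i, X → Z i)

/-- The functional whose decompositions are minimised: the dual total correlation minus half of
the entropy. -/
noncomputable def pot (u : X → ℝ) : ℝ := condEnt triv u / 2 - ∑ i, condEnt (g i) u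

lemma pot_smul (s : ℝ) (u : X → ℝ) : pot g (s • u) = s * pot g u := by
  simp only [pot, condEnt_smul, ← Finset.mul_sum]; ring

lemma pot_zero : pot g 0 = 0 := by
  simpa using pot_smul g 0 0

lemma continuous_pot : Continuous (pot g) :=
  ((continuous_condEnt _).div_const 2).sub
    (continuous_finsetSum _ fun i _ => continuous_condEnt (g i))

/-- The term s * `pot g u` is the potential of the piece split off. It cancels the entropies of u in
the derivative, so that only divergences remain. -/
lemma hasDerivAt_pot {w u : X → ℝ} (hw : 0 ≤ w) (h : ∀ x, w x = 0 → u x = 0) :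
    HasDerivAt (fun s : ℝ => pot g (w - s • u) + s * pot g u)
      (∑ i, condKL (g i) u w - condKL triv u w / 2) 0 := by
  have h1 := ((hasDerivAt_condEnt hw h triv).div_const 2).sub
    (HasDerivAt.fun_sum (u := univ) fun i _ => hasDerivAt_condEnt hw h (g i))
  refine (h1.add ((hasDerivAt_id (0 : ℝ)).mul_const (pot g u))).congr_deriv ?_
  rw [Finset.sum_sub_distrib, Finset.sum_neg_distrib, pot]
  ring

/-- If no small piece proportional to `u` can be split from `w` to lower the potential, the
divergence of `u` from `w` tensorizes approximately. -/
lemma condKL_le_of_forall_split {w u : X → ℝ} (hw : 0 ≤ w)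
    (h : ∀ x, w x = 0 → u x = 0)
    (hmin : ∀ s : ℝ, 0 ≤ s → 0 ≤ w - s • u → pot g w ≤ pot g (w - s • u) + pot g (s • u)) :
    condKL triv u w ≤ 2 * ∑ i, condKL (g i) u w := by
  have hd := (hasDerivAt_pot g hw h).tendsto_slope_zero_right
  have hev : ∀ᶠ s : ℝ in nhdsWithin 0 (Set.Ioi 0), 0 ≤ w - s • u := by
    have : ∀ x, ∀ᶠ s : ℝ in nhdsWithin 0 (Set.Ioi 0), 0 ≤ w x - s * u x := fun x => by
      rcases (hw x).eq_or_lt with h0 | h0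
      · filter_upwards with s
        simp only [Pi.zero_apply] at h0
        simp [← h0, h x h0.symm]
      · have hc : Filter.Tendsto (fun s : ℝ => w x - s * u x) (nhds 0) (nhds (w x - 0 * u x)) :=
          (continuous_const.sub (continuous_id.mul continuous_const)).tendsto 0
        rw [zero_mul, sub_zero] at hc
        exact ((hc.eventually (lt_mem_nhds h0)).filter_mono nhdsWithin_le_nhds).mono fun s hs => hs.le
    filter_upwards [Filter.eventually_all.2 this] with s hs x using hs x
  -- Minimality makes the difference quotients nonnegative for small s > 0; only the one-sided limit
  -- is available.
  have := ge_of_tendsto hd (b := 0) (by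
    filter_upwards [hev, self_mem_nhdsWithin] with s hs hs0
    have h1 := hmin s (le_of_lt hs0) hs
    rw [pot_smul] at h1
    simp only [zero_add, zero_smul, sub_zero, zero_mul, add_zero, smul_eq_mul]
    exact mul_nonneg (inv_nonneg.2 (le_of_lt hs0)) (by linarith))
  linarith

/-- The decompositions of `w` into pieces indexed by `κ`. -/
def decomps (κ : Type*) [Fintype κ] (w : X → ℝ) : Set (κ → X → ℝ) :=
  {W | (∀ j, 0 ≤ W j) ∧ ∑ j, W j = w}

omit [Fintype X] in
lemma isCompact_decomps (κ : Type*) [Fintype κ] (w : X → ℝ) : IsCompact (decomps κ w) := by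
  have hsub : decomps κ w ⊆ Set.Icc 0 (fun _ => w) := fun W hW =>
    ⟨hW.1, fun j => by
      rw [← hW.2]
      exact Finset.single_le_sum (f := W) (fun j _ => hW.1 j) (mem_univ j)⟩
  refine isCompact_Icc.of_isClosed_subset (IsClosed.inter ?_ ?_) hsub
  · exact isClosed_le continuous_const continuous_id
  · exact isClosed_eq (continuous_finsetSum _ fun j _ => continuous_apply j) continuous_const

/-- A decomposition into more pieces than points can be changed into one with a vanishing piece
without increasing the potential. -/
lemma exists_decomps_eq_zero {κ : Type*} [Fintype κ] (hκ : Fintype.card X < Fintype.card κ)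
    {w : X → ℝ} {W : κ → X → ℝ} (hW : W ∈ decomps κ w) :
    ∃ V ∈ decomps κ w, ∑ j, pot g (V j) ≤ ∑ j, pot g (W j) ∧ ∃ k, V k = 0 := by
  by_cases h0 : ∃ k, W k = 0
  · exact ⟨W, hW, le_rfl, h0⟩
  push Not at h0
  have hdep : ¬ LinearIndependent ℝ W := fun h => by
    have := h.fintype_card_le_finrank
    rw [Module.finrank_fintype_fun_eq_card] at this
    omega
  obtain ⟨c, hc, k, hk⟩ := Fintype.not_linearIndependent_iff.1 hdep
  -- The sign of the linear relation is chosen so that moving against it does not raise the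
  -- potential, which is linear under rescaling of the pieces.
  obtain ⟨c, hc, hck, hcG⟩ : ∃ c : κ → ℝ, ∑ j, c j • W j = 0 ∧ c k ≠ 0 ∧
      ∑ j, c j * pot g (W j) ≤ 0 := by
    rcases le_total (∑ j, c j * pot g (W j)) 0 with h | h
    · exact ⟨c, hc, hk, h⟩
    · refine ⟨-c, by simpa using hc, by simpa using hk, by simpa using h⟩
  have hneg : ∃ j, c j < 0 := by
    by_contra! hpos
    have h1 : ∀ j ∈ univ, c j • W j = 0 :=
      (Finset.sum_eq_zero_iff_of_nonneg fun j _ => smul_nonneg (hpos j) (hW.1 j)).1 hc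
    rcases smul_eq_zero.1 (h1 k (mem_univ k)) with h | h
    · exact hck h
    · exact h0 k h
  obtain ⟨l, hl⟩ := hneg
  have : Nonempty κ := ⟨k⟩
  -- The most negative coefficient is the first to empty its piece: all factors 1 − c j / c m are
  -- nonnegative, and the one at m is zero.
  obtain ⟨m, hm⟩ := Finite.exists_min c
  have hcm : c m < 0 := (hm l).trans_lt hl
  have hco : ∀ j, 0 ≤ 1 - c j / c m := fun j => by
    have : c j / c m ≤ 1 := by
      rw [div_le_one_of_neg hcm]; exact hm j
    linarith
  refine ⟨fun j => (1 - c j / c m) • W j, ⟨fun j => smul_nonneg (hco j) (hW.1 j), ?_⟩, ?_, m, ?_⟩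
  · have : ∑ j, (c j / c m) • W j = (c m)⁻¹ • ∑ j, c j • W j := by
      rw [Finset.smul_sum]
      exact Finset.sum_congr rfl fun j _ => by rw [smul_smul]; congr 1; ring
    simp only [sub_smul, one_smul, Finset.sum_sub_distrib, this, hc, smul_zero, sub_zero, hW.2]
  · have : ∑ j, pot g ((1 - c j / c m) • W j) =
        ∑ j, pot g (W j) - (c m)⁻¹ * ∑ j, c j * pot g (W j) := by
      rw [Finset.mul_sum, ← Finset.sum_sub_distrib]
      exact Finset.sum_congr rfl fun j _ => by rw [pot_smul]; ring
    rw [this]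
    have := mul_nonneg_of_nonpos_of_nonpos (inv_nonpos.2 hcm.le) hcG
    linarith
  · simp [div_self hcm.ne]

/-- Used with F the identity and F the potential: the spare slot k holds nothing before the split
and so does not appear on the right. -/
lemma sum_update_update {κ E M : Type*} [Fintype κ] [DecidableEq κ] [AddCommGroup M] (V : κ → E)
    {j k : κ} (hjk : j ≠ k) (a b : E) (F : E → M) (hF : F (V k) = 0) :
    ∑ i, F (Function.update (Function.update V j a) k b i) =
      ∑ i, F (V i) - F (V j) + F a + F b := by
  have hk' : k ∈ (univ.erase j) := by simp [hjk.symm]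
  rw [← Finset.add_sum_erase _ _ (mem_univ j), ← Finset.add_sum_erase _ _ hk',
    ← Finset.add_sum_erase _ (fun i => F (V i)) (mem_univ j),
    ← Finset.add_sum_erase _ (fun i => F (V i)) hk', hF]
  have hrest : ∑ i ∈ (univ.erase j).erase k,
      F (Function.update (Function.update V j a) k b i) =
      ∑ i ∈ (univ.erase j).erase k, F (V i) := by
    refine Finset.sum_congr rfl fun i hi => ?_
    simp only [Finset.mem_erase, mem_univ, and_true] at hi
    rw [Function.update_of_ne hi.1, Function.update_of_ne hi.2]
  rw [hrest, Function.update_self, Function.update_of_ne hjk, Function.update_self]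
  abel

/-- An optimal decomposition: its pieces satisfy approximate tensorization of entropy, and it does
not increase the potential. -/
lemma exists_optimal_decomps {w : X → ℝ} (hw : 0 ≤ w) :
    ∃ W ∈ decomps (Fin (Fintype.card X + 1)) w, ∑ j, pot g (W j) ≤ pot g w ∧
      ∀ j, ∀ u : X → ℝ, 0 ≤ u → (∀ x, W j x = 0 → u x = 0) →
        condKL triv u (W j) ≤ 2 * ∑ i, condKL (g i) u (W j) := by
  classical
  set κ := Fin (Fintype.card X + 1)
  have h0 : Pi.single (0 : κ) w ∈ decomps κ w := by
    refine ⟨fun j => ?_, by simp⟩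
    by_cases hj : j = 0
    · subst hj; simpa using hw
    · simp [hj]
  have hcont : Continuous fun W : κ → X → ℝ => ∑ j, pot g (W j) :=
    continuous_finsetSum _ fun j _ => (continuous_pot g).comp (continuous_apply j)
  obtain ⟨W, hW, hmin⟩ := (isCompact_decomps κ w).exists_isMinOn ⟨_, h0⟩ hcont.continuousOn
  -- There is one slot more than the dimension, so a minimiser can be taken with an empty slot,
  -- available to receive a piece split off.
  obtain ⟨V, hV, hVW, k, hk⟩ := exists_decomps_eq_zero g (by simp [κ]) hW
  have hminV : ∀ U ∈ decomps κ w, ∑ j, pot g (V j) ≤ ∑ j, pot g (U j) := fun U hU =>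
    hVW.trans (hmin hU)
  refine ⟨V, hV, ?_, fun j u hu huV => ?_⟩
  · refine (hminV _ h0).trans_eq ?_
    rw [Finset.sum_eq_single (0 : κ) (fun j _ hj => by rw [Pi.single_eq_of_ne hj, pot_zero])
      (by simp), Pi.single_eq_same]
  refine condKL_le_of_forall_split g (hV.1 j) huV fun s hs hsu => ?_
  by_cases hjk : j = k
  · subst hjk
    have hz : s • u = 0 := by
      ext x; simp [huV x (by simp [hk])]
    simp [hz, pot_zero]
  have hkj : k ≠ j := Ne.symm hjk
  set U := Function.update (Function.update V j (V j - s • u)) k (s • u) with hU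
  have hUd : U ∈ decomps κ w := by
    refine ⟨fun i => ?_, ?_⟩
    · rw [hU]
      by_cases hik : i = k
      · subst hik; rw [Function.update_self]; exact smul_nonneg hs hu
      rw [Function.update_of_ne hik]
      by_cases hij : i = j
      · subst hij; rwa [Function.update_self]
      rw [Function.update_of_ne hij]; exact hV.1 i
    · have := sum_update_update V hjk (V j - s • u) (s • u) id hk
      simp only [id, ← hU] at this
      rw [this, hV.2]; abel
  have h1 := hminV U hUd
  rw [hU, sum_update_update V hjk _ _ (pot g) (by rw [hk, pot_zero])] at h1
  linarith

end Decomposition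

/-! ### Herbst's argument -/

section Herbst

variable {X Z : Type*} [Fintype X]

/-- The second-order bound is written with 1 − exp (−y) because, after weighting by a tilt, this
first-order part sums to zero. -/
lemma mul_exp_le {y τ : ℝ} (hy : |y| ≤ τ) (hτ : τ ≤ 1) : y ≤ 1 - exp (-y) + τ ^ 2 := by
  have h1 := abs_exp_sub_one_sub_id_le (x := -y) (by rw [abs_neg]; exact hy.trans hτ)
  have h2 := (abs_le.1 h1).2
  have h3 : (-y) ^ 2 ≤ τ ^ 2 := by
    rw [neg_sq, ← sq_abs]; exact pow_le_pow_left₀ (abs_nonneg y) hy 2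
  linarith

/-- The conditional divergence of an exponential tilt is controlled by the square of the
oscillation of the exponent along the fibres. -/
lemma condKL_tilt_le [Fintype Z] (g : X → Z) {w F : X → ℝ} (hw : 0 ≤ w) {τ : ℝ} (hτ1 : τ ≤ 1)
    (hF : ∀ x y, g x = g y → F x - F y ≤ τ) :
    condKL g (fun x => w x * exp (F x)) w ≤ τ ^ 2 * ∑ x, w x * exp (F x) := by
  classical
  set u : X → ℝ := fun x => w x * exp (F x) with hu
  have hun : 0 ≤ u := fun x => mul_nonneg (hw x) (exp_pos _).le
  have key : ∀ x, u x * (log (u x) - log (w x) - (log (push g u (g x)) - log (push g w (g x)))) ≤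
      u x - w x * (push g u (g x) / push g w (g x)) + τ ^ 2 * u x := fun x => by
    rcases (hw x).eq_or_lt with h0 | h0
    · simp only [Pi.zero_apply] at h0
      simp [hu, ← h0]
    simp only [Pi.zero_apply] at h0
    have hu0 : 0 < u x := mul_pos h0 (exp_pos _)
    have hpw : 0 < push g w (g x) := h0.trans_le (le_push hw g x)
    have hpu : 0 < push g u (g x) := hu0.trans_le (le_push hun g x)
    -- R is the w-average of exp F over the fibre, so log R is within τ of F x.
    set R := push g u (g x) / push g w (g x) with hR
    have hR0 : 0 < R := div_pos hpu hpw
    have hup : R ≤ exp (F x + τ) := by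
      rw [hR, div_le_iff₀ hpw, push, push, Finset.mul_sum]
      refine Finset.sum_le_sum fun y hy => ?_
      have := hF y x (Finset.mem_filter.1 hy).2
      rw [hu, mul_comm (exp (F x + τ))]
      exact mul_le_mul_of_nonneg_left (exp_le_exp.2 (by linarith)) (hw y)
    have hlo : exp (F x - τ) ≤ R := by
      rw [hR, le_div_iff₀ hpw, push, push, Finset.mul_sum]
      refine Finset.sum_le_sum fun y hy => ?_
      have := hF x y (Finset.mem_filter.1 hy).2.symm
      rw [hu, mul_comm (exp (F x - τ))]
      exact mul_le_mul_of_nonneg_left (exp_le_exp.2 (by linarith)) (hw y)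
    have hlup : log R ≤ F x + τ := (log_le_iff_le_exp hR0).2 hup
    have hllo : F x - τ ≤ log R := (le_log_iff_exp_le hR0).2 hlo
    have h1 := mul_exp_le (y := F x - log R) (abs_le.2 ⟨by linarith, by linarith⟩) hτ1
    have h2 := mul_le_mul_of_nonneg_left h1 hu0.le
    have e1 : log (u x) - log (w x) - (log (push g u (g x)) - log (push g w (g x))) =
        F x - log R := by
      rw [hR, log_div hpu.ne' hpw.ne', hu]
      simp only
      rw [log_mul h0.ne' (exp_pos _).ne', log_exp]; ring
    have e2 : u x * exp (-(F x - log R)) = w x * R := by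
      rw [hu, neg_sub, exp_sub, exp_log hR0]
      field_simp
    rw [e1]
    calc u x * (F x - log R) ≤ u x * (1 - exp (-(F x - log R)) + τ ^ 2) := h2
      _ = u x - u x * exp (-(F x - log R)) + τ ^ 2 * u x := by ring
      _ = _ := by rw [e2]
  -- This is the cancellation of the first-order terms.
  have hz : ∑ x, w x * (push g u (g x) / push g w (g x)) = ∑ x, u x := by
    rw [← sum_push_mul g w (fun z => push g u z / push g w z), ← sum_push g u]
    refine Finset.sum_congr rfl fun z _ => ?_
    by_cases h : push g w z = 0
    · have hwu : ∀ x, w x = 0 → u x = 0 := fun x hx => by simp [hu, hx]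
      rw [push_eq_zero hw hwu g z h, h, zero_mul]
    · field_simp
  calc condKL g u w ≤ ∑ x, (u x - w x * (push g u (g x) / push g w (g x)) + τ ^ 2 * u x) :=
        Finset.sum_le_sum fun x _ => key x
    _ = τ ^ 2 * ∑ x, u x := by
        rw [Finset.sum_add_distrib, Finset.sum_sub_distrib, hz, sub_self, zero_add,
          Finset.mul_sum]

lemma condKL_triv_tilt {w F : X → ℝ} (hw : 0 ≤ w) (hw1 : ∑ x, w x = 1) :
    condKL triv (fun x => w x * exp (F x)) w =
      ∑ x, w x * exp (F x) * F x - (∑ x, w x * exp (F x)) * log (∑ x, w x * exp (F x)) := by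
  rw [condKL, Finset.sum_mul, ← Finset.sum_sub_distrib]
  refine Finset.sum_congr rfl fun x _ => ?_
  rcases (hw x).eq_or_lt with h0 | h0
  · simp only [Pi.zero_apply] at h0
    simp [← h0]
  simp only [Pi.zero_apply] at h0
  simp only [push_triv]
  rw [hw1, log_one, log_mul h0.ne' (exp_pos _).ne', log_exp]; ring

variable {ι : Type*} [Fintype ι] {Y : ι → Type*} [∀ i, Fintype (Y i)] (g : ∀ i, X → Y i)

/-- Herbst's argument: approximate tensorization of entropy implies sub-Gaussian concentration. -/
lemma sum_mul_exp_le {w : X → ℝ} (hw : 0 ≤ w) (hw1 : ∑ x, w x = 1)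
    (hAT : ∀ u : X → ℝ, 0 ≤ u → (∀ x, w x = 0 → u x = 0) →
      condKL triv u w ≤ 2 * ∑ i, condKL (g i) u w)
    {f : X → ℝ} {n : ℝ} (hn : 0 < n) (hcard : Fintype.card ι = n)
    (hf : ∀ i x y, g i x = g i y → f x - f y ≤ 1 / n) {κ : ℝ} (hκ : 0 < κ) (hκn : κ ≤ n) :
    ∑ x, w x * exp (κ * f x) ≤ exp (κ * (∑ x, w x * f x + 2 * κ / n)) := by
  set Q : ℝ → ℝ := fun t => ∑ x, w x * exp (t * f x) with hQ
  set Q' : ℝ → ℝ := fun t => ∑ x, w x * exp (t * f x) * f x with hQ'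
  have hQpos : ∀ t, 0 < Q t := fun t => by
    have h0 : ∀ x ∈ univ, 0 ≤ w x * exp (t * f x) := fun x _ => mul_nonneg (hw x) (exp_pos _).le
    refine (Finset.sum_nonneg h0).lt_of_ne fun h => ?_
    have h1 := (Finset.sum_eq_zero_iff_of_nonneg h0).1 h.symm
    have : ∑ x, w x = 0 := Finset.sum_eq_zero fun x hx => by
      simpa [(exp_pos _).ne'] using h1 x hx
    rw [hw1] at this
    exact one_ne_zero this
  have hQd : ∀ t, HasDerivAt Q (Q' t) t := fun t => by
    refine HasDerivAt.fun_sum fun x _ => ?_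
    have := (((hasDerivAt_id t).mul_const (f x)).exp).const_mul (w x)
    refine this.congr_deriv ?_
    simp only [id]; ring
  have hlogd : ∀ t, HasDerivAt (fun t => log (Q t)) (Q' t / Q t) t := fun t =>
    (hQd t).log (hQpos t).ne'
  have hQ0 : Q 0 = 1 := by simp [hQ, hw1]
  have hQ'0 : Q' 0 = ∑ x, w x * f x := by simp [hQ']
  have hent : ∀ t, 0 < t → t ≤ n → t * (Q' t / Q t) - log (Q t) ≤ 2 * t ^ 2 / n := by
    intro t ht htn
    have hτ : t / n ≤ 1 := (div_le_one hn).2 htn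
    have h1 := hAT (fun x => w x * exp (t * f x)) (fun x => mul_nonneg (hw x) (exp_pos _).le)
      (fun x hx => by simp [hx])
    rw [condKL_triv_tilt hw hw1] at h1
    have h2 : ∑ i, condKL (g i) (fun x => w x * exp (t * f x)) w ≤ ∑ _i : ι, (t / n) ^ 2 * Q t :=
      Finset.sum_le_sum fun i _ => condKL_tilt_le (g i) hw hτ fun x y hxy => by
        have := mul_le_mul_of_nonneg_left (hf i x y hxy) ht.le
        rw [← mul_sub]; simpa [div_eq_mul_inv] using this
    rw [Finset.sum_const, Finset.card_univ, nsmul_eq_mul, hcard] at h2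
    have e1 : ∑ x, w x * exp (t * f x) * (t * f x) = t * Q' t := by
      rw [hQ', Finset.mul_sum]
      exact Finset.sum_congr rfl fun x _ => by ring
    rw [e1] at h1
    have h3 : t * Q' t - Q t * log (Q t) ≤ 2 * t ^ 2 / n * Q t := by
      calc t * Q' t - Q t * log (Q t) ≤ 2 * (n * ((t / n) ^ 2 * Q t)) := h1.trans (by linarith)
        _ = _ := by field_simp
    rw [← mul_le_mul_iff_left₀ (hQpos t)]
    calc (t * (Q' t / Q t) - log (Q t)) * Q t = t * Q' t - Q t * log (Q t) := by
          field_simp [(hQpos t).ne']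
      _ ≤ _ := h3
  -- The entropy bound says exactly that (log Q t)/t has derivative at most 2/n; its limit at 0 is
  -- the mean of f.
  set h : ℝ → ℝ := fun t => log (Q t) / t - 2 * t / n with hh
  have hhd : ∀ t, 0 < t → HasDerivAt h ((Q' t / Q t * t - log (Q t) * 1) / t ^ 2 - 2 / n) t :=
    fun t ht => by
      refine ((hlogd t).div (hasDerivAt_id t) ht.ne').sub ?_
      exact (((hasDerivAt_id t).const_mul 2).div_const n).congr_deriv (by simp)
  have hanti : AntitoneOn h (Set.Ioc 0 κ) := by
    refine antitoneOn_of_deriv_nonpos (convex_Ioc 0 κ)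
      (fun t ht => (hhd t ht.1).continuousAt.continuousWithinAt)
      (fun t ht => (hhd t (interior_subset ht).1).differentiableAt.differentiableWithinAt)
      fun t ht => ?_
    have ht' := interior_subset ht
    rw [(hhd t ht'.1).deriv]
    have h1 := hent t ht'.1 (ht'.2.trans hκn)
    have ht2 : 0 < t ^ 2 := pow_pos ht'.1 2
    have : (Q' t / Q t * t - log (Q t) * 1) / t ^ 2 ≤ 2 / n := by
      rw [div_le_iff₀ ht2]
      calc Q' t / Q t * t - log (Q t) * 1 = t * (Q' t / Q t) - log (Q t) := by ring
        _ ≤ 2 * t ^ 2 / n := h1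
        _ = _ := by ring
    linarith
  have hlim : Filter.Tendsto h (nhdsWithin 0 (Set.Ioi 0)) (nhds (Q' 0 / Q 0 - 0)) := by
    refine Filter.Tendsto.sub ?_ ?_
    · refine (hlogd 0).tendsto_slope_zero_right.congr fun t => ?_
      simp [hQ0, div_eq_inv_mul]
    · have : Filter.Tendsto (fun t : ℝ => 2 * t / n) (nhds 0) (nhds (2 * 0 / n)) :=
        ((continuous_const.mul continuous_id).div_const n).tendsto 0
      rw [mul_zero, zero_div] at this
      exact this.mono_left nhdsWithin_le_nhds
  have hfin : h κ ≤ Q' 0 / Q 0 - 0 := by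
    refine ge_of_tendsto hlim ?_
    filter_upwards [Ioc_mem_nhdsGT hκ] with t ht
    exact hanti ht ⟨hκ, le_rfl⟩ ht.2
  rw [hQ0, hQ'0, div_one, sub_zero] at hfin
  rw [← log_le_iff_le_exp (hQpos κ)]
  have : log (Q κ) / κ ≤ ∑ x, w x * f x + 2 * κ / n := by simp only [hh] at hfin; linarith
  rw [div_le_iff₀ hκ] at this
  linarith

end Herbst

/-! ### Reducing the number of terms of a mixture -/

section Sampling

variable {X κ : Type*} [Fintype X] [Fintype κ]

/-- Maurey's empirical approximation of an average. -/
lemma exists_empirical {w : X → ℝ} (hw : 0 ≤ w) {p : κ → ℝ} (hp : 0 ≤ p) (hp1 : ∑ j, p j = 1)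
    {a : κ → X → ℝ} {b : X → ℝ} (hb : ∀ x, ∑ j, p j * a j x = b x) {V : ℝ}
    (hV : ∑ j, p j * ∑ x, w x * a j x ^ 2 ≤ V) (M : ℕ) :
    ∃ J : Fin M → κ, ∑ x, w x * (∑ k, a (J k) x - M * b x) ^ 2 ≤ M * V := by
  induction M with
  | zero => exact ⟨Fin.elim0, by simp⟩
  | succ M ih =>
    obtain ⟨J, hJ⟩ := ih
    set D : X → ℝ := fun x => ∑ k, a (J k) x - M * b x with hD
    -- When j is drawn from p the cross term has mean zero and the variance is at most the second
    -- moment, so some j does no worse than average.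
    have hx : ∀ x, ∑ j, p j * (D x + a j x - b x) ^ 2 ≤
        D x ^ 2 + ∑ j, p j * a j x ^ 2 := fun x => by
      have e : ∀ j, p j * (D x + a j x - b x) ^ 2 =
          (D x - b x) ^ 2 * p j + 2 * (D x - b x) * (p j * a j x) + p j * a j x ^ 2 :=
        fun j => by ring
      simp only [e, Finset.sum_add_distrib, ← Finset.mul_sum, hp1, hb]
      nlinarith [sq_nonneg (b x)]
    have hsum : ∑ j, p j * ∑ x, w x * (D x + a j x - b x) ^ 2 ≤ M * V + V := by
      calc ∑ j, p j * ∑ x, w x * (D x + a j x - b x) ^ 2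
          = ∑ x, w x * ∑ j, p j * (D x + a j x - b x) ^ 2 := by
            simp only [Finset.mul_sum]
            rw [Finset.sum_comm]
            exact Finset.sum_congr rfl fun x _ => Finset.sum_congr rfl fun j _ => by ring
        _ ≤ ∑ x, w x * (D x ^ 2 + ∑ j, p j * a j x ^ 2) :=
            Finset.sum_le_sum fun x _ => mul_le_mul_of_nonneg_left (hx x) (hw x)
        _ = ∑ x, w x * D x ^ 2 + ∑ j, p j * ∑ x, w x * a j x ^ 2 := by
            simp only [mul_add, Finset.sum_add_distrib, Finset.mul_sum]
            congr 1
            rw [Finset.sum_comm]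
            exact Finset.sum_congr rfl fun x _ => Finset.sum_congr rfl fun j _ => by ring
        _ ≤ M * V + V := add_le_add hJ hV
    obtain ⟨j, hj⟩ : ∃ j, ∑ x, w x * (D x + a j x - b x) ^ 2 ≤ M * V + V := by
      by_contra! hcon
      obtain ⟨l, -, hl⟩ : ∃ l ∈ univ, 0 < p l := by
        by_contra! h0
        have := Finset.sum_nonpos h0
        linarith
      have : ∑ j, p j * (M * V + V) < ∑ j, p j * ∑ x, w x * (D x + a j x - b x) ^ 2 :=
        Finset.sum_lt_sum (fun j _ => mul_le_mul_of_nonneg_left (hcon j).le (hp j))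
          ⟨l, mem_univ l, mul_lt_mul_of_pos_left (hcon l) hl⟩
      rw [← Finset.sum_mul, hp1] at this
      linarith
    refine ⟨Fin.snoc (α := fun _ => κ) J j, ?_⟩
    have e : ∀ x, ∑ k, a (Fin.snoc (α := fun _ => κ) J j k) x - ((M + 1 : ℕ) : ℝ) * b x =
        D x + a j x - b x := fun x => by
      rw [Fin.sum_univ_castSucc]
      simp only [Fin.snoc_castSucc, Fin.snoc_last, hD]
      push_cast; ring
    simp only [e]
    push_cast; linarith

/-- The correction −q + w makes the divergence integrand nonnegative pointwise, so the part with
large density can be isolated. -/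
lemma mul_log_sub_log_nonneg {q w : ℝ} (hq : 0 ≤ q) (hw : 0 ≤ w) (h : w = 0 → q = 0) :
    0 ≤ q * (log q - log w) - q + w := by
  rcases hq.eq_or_lt with h0 | h0
  · simpa [← h0] using hw
  have hw0 : 0 < w := hw.lt_of_ne fun h' => h0.ne' (h h'.symm)
  have h1 := log_le_sub_one_of_pos (div_pos hw0 h0)
  rw [log_div hw0.ne' h0.ne'] at h1
  have h2 := mul_le_mul_of_nonneg_left h1 h0.le
  have e : q * (w / q - 1) = w - q := by field_simp
  linarith

/-- A mixture with bounded mutual information is mostly exhausted by few of its terms, each of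
them being used with the same weight. -/
lemma exists_subpieces {w : X → ℝ} (hw : 0 ≤ w) (hw1 : ∑ x, w x = 1) {p : κ → ℝ}
    (hp : ∀ j, 0 < p j) (hp1 : ∑ j, p j = 1) {q : κ → X → ℝ} (hq : ∀ j, 0 ≤ q j)
    (hq1 : ∀ j, ∑ x, q j x = 1) (hpq : ∀ x, ∑ j, p j * q j x = w x) {I : ℝ} (hI0 : 0 ≤ I)
    (hI : ∑ j, p j * ∑ x, q j x * (log (q j x) - log (w x)) ≤ I) {η : ℝ} (hη : 0 < η)
    {M : ℕ} (hM : exp (2 + I / η) / η ^ 2 ≤ M) :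
    ∃ (J : Fin M → κ) (h : Fin M → X → ℝ), (∀ k, 0 ≤ h k) ∧
      (∀ k x, M * h k x ≤ q (J k) x) ∧ (∀ x, ∑ k, h k x ≤ w x) ∧
      1 - 2 * η ≤ ∑ k, ∑ x, h k x := by
  classical
  set L := 2 + I / η with hL
  have hM0 : (0 : ℝ) < M := (div_pos (exp_pos _) (pow_pos hη 2)).trans_le hM
  have hwq : ∀ j x, w x = 0 → q j x = 0 := fun j x hx => by
    have h1 := (Finset.sum_eq_zero_iff_of_nonneg fun j _ => mul_nonneg (hp j).le (hq j x)).1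
      ((hpq x).trans hx) j (mem_univ j)
    exact (mul_eq_zero.1 h1).resolve_left (hp j).ne'
  set a : κ → X → ℝ := fun j x => if q j x ≤ exp L * w x then q j x / w x else 0 with ha
  set b : X → ℝ := fun x => ∑ j, p j * a j x with hb
  have ha0 : ∀ j x, 0 ≤ a j x := fun j x => by
    simp only [ha]; split_ifs
    · exact div_nonneg (hq j x) (hw x)
    · exact le_rfl
  have haq : ∀ j x, a j x ≤ q j x / w x := fun j x => by
    simp only [ha]; split_ifs
    · exact le_rfl
    · exact div_nonneg (hq j x) (hw x)
  have hwdiv : ∀ j x, w x * (q j x / w x) = q j x := fun j x => by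
    by_cases hx : w x = 0
    · simp [hx, hwq j x hx]
    · field_simp
  have hwaq : ∀ j x, w x * a j x ≤ q j x := fun j x =>
    (mul_le_mul_of_nonneg_left (haq j x) (hw x)).trans_eq (hwdiv j x)
  have haL : ∀ j x, a j x ≤ exp L := fun j x => by
    simp only [ha]; split_ifs with h
    · exact div_le_of_le_mul₀ (hw x) (exp_pos L).le h
    · exact (exp_pos L).le
  have hb1 : ∀ x, b x ≤ 1 := fun x => by
    calc b x ≤ ∑ j, p j * (q j x / w x) :=
          Finset.sum_le_sum fun j _ => mul_le_mul_of_nonneg_left (haq j x) (hp j).le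
      _ = w x / w x := by simp only [← mul_div_assoc, ← Finset.sum_div, hpq]
      _ ≤ 1 := div_self_le_one _
  have hV : ∑ j, p j * ∑ x, w x * a j x ^ 2 ≤ exp L := by
    have h1 : ∀ j, ∑ x, w x * a j x ^ 2 ≤ exp L := fun j => by
      calc ∑ x, w x * a j x ^ 2 ≤ ∑ x, exp L * q j x := by
            refine Finset.sum_le_sum fun x _ => ?_
            calc w x * a j x ^ 2 = a j x * (w x * a j x) := by ring
              _ ≤ exp L * q j x :=
                mul_le_mul (haL j x) (hwaq j x) (mul_nonneg (hw x) (ha0 j x)) (exp_pos L).le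
        _ = exp L := by rw [← Finset.mul_sum, hq1, mul_one]
    calc ∑ j, p j * ∑ x, w x * a j x ^ 2 ≤ ∑ j, p j * exp L :=
          Finset.sum_le_sum fun j _ => mul_le_mul_of_nonneg_left (h1 j) (hp j).le
      _ = exp L := by rw [← Finset.sum_mul, hp1, one_mul]
  have hmass : 1 - η ≤ ∑ x, w x * b x := by
    have e : ∑ x, w x * b x = ∑ j, p j * ∑ x, w x * a j x := by
      simp only [hb, Finset.mul_sum]
      rw [Finset.sum_comm]
      exact Finset.sum_congr rfl fun x _ => Finset.sum_congr rfl fun j _ => by ring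
    have hpt : ∀ j x, (1 + I / η) * (q j x - w x * a j x) ≤
        q j x * (log (q j x) - log (w x)) - q j x + w x := fun j x => by
      have hnn := mul_log_sub_log_nonneg (hq j x) (hw x) (hwq j x)
      by_cases h : q j x ≤ exp L * w x
      · simp only [ha, if_pos h, hwdiv, sub_self, mul_zero]; exact hnn
      · simp only [ha, if_neg h, mul_zero, sub_zero]
        push Not at h
        have hq0 : 0 < q j x := (mul_nonneg (exp_pos L).le (hw x)).trans_lt h
        have hw0 : 0 < w x := (hw x).lt_of_ne fun h' => hq0.ne' (hwq j x h'.symm)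
        have h1 := log_le_log (mul_pos (exp_pos L) hw0) h.le
        rw [log_mul (exp_pos L).ne' hw0.ne', log_exp] at h1
        have h2 : q j x * L ≤ q j x * (log (q j x) - log (w x)) :=
          mul_le_mul_of_nonneg_left (by linarith) hq0.le
        rw [hL] at h2
        linarith
    have hB : (1 + I / η) * (1 - ∑ x, w x * b x) ≤ I := by
      calc (1 + I / η) * (1 - ∑ x, w x * b x)
          = ∑ j, p j * ∑ x, (1 + I / η) * (q j x - w x * a j x) := by
            rw [e]
            simp only [← Finset.mul_sum, Finset.sum_sub_distrib, hq1, mul_sub, mul_one,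
              ← Finset.sum_mul, hp1]
            rw [one_mul, Finset.mul_sum]
            congr 1
            exact Finset.sum_congr rfl fun j _ => by ring
        _ ≤ ∑ j, p j * ∑ x, (q j x * (log (q j x) - log (w x)) - q j x + w x) :=
            Finset.sum_le_sum fun j _ => mul_le_mul_of_nonneg_left
              (Finset.sum_le_sum fun x _ => hpt j x) (hp j).le
        _ = ∑ j, p j * ∑ x, q j x * (log (q j x) - log (w x)) := by
            refine Finset.sum_congr rfl fun j _ => ?_
            rw [Finset.sum_add_distrib, Finset.sum_sub_distrib, hq1, hw1]; ring
        _ ≤ I := hI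
    have h1 : (1 + I / η) * η = η + I := by field_simp
    have h2 : (1 + I / η) * (1 - ∑ x, w x * b x) ≤ (1 + I / η) * η := by linarith
    have h3 := le_of_mul_le_mul_left h2 (by positivity)
    linarith
  obtain ⟨J, hJ⟩ := exists_empirical hw (fun j => (hp j).le) hp1 (b := b) (fun _ => rfl) hV M
  set S : X → ℝ := fun x => ∑ k, a (J k) x with hS
  have hS0 : ∀ x, 0 ≤ S x := fun x => Finset.sum_nonneg fun k _ => ha0 _ x
  -- Dividing by the larger of M and S serves two bounds at once: M caps each piece by q / M, and S
  -- caps the sum of the pieces by w.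
  have hmax : ∀ x, 0 < max (M : ℝ) (S x) := fun x => lt_max_of_lt_left hM0
  refine ⟨J, fun k x => w x * a (J k) x / max (M : ℝ) (S x), fun k x =>
    div_nonneg (mul_nonneg (hw x) (ha0 _ x)) (hmax x).le, fun k x => ?_, fun x => ?_, ?_⟩
  · rw [← mul_div_assoc, div_le_iff₀ (hmax x), mul_comm]
    exact mul_le_mul (hwaq _ x) (le_max_left _ _) hM0.le (hq _ x)
  · rw [← Finset.sum_div, ← Finset.mul_sum, mul_div_assoc]
    exact mul_le_of_le_one_right (hw x) ((div_le_one (hmax x)).2 (le_max_right _ _))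
  · rw [Finset.sum_comm]
    -- Where S ≤ M this is −t ≤ t²/(2η) + η/2 with t = S/M − b; elsewhere the quotient is 1, which
    -- dominates b.
    have hpt : ∀ x, w x * b x - (w x * (S x - M * b x) ^ 2 / (M ^ 2 * (2 * η)) + w x * (η / 2)) ≤
        ∑ k, w x * a (J k) x / max (M : ℝ) (S x) := fun x => by
      rw [← Finset.sum_div, ← Finset.mul_sum]
      have hpt' : b x - ((S x - M * b x) ^ 2 / (M ^ 2 * (2 * η)) + η / 2) ≤
          S x / max (M : ℝ) (S x) := by
        rcases le_total (S x) M with h | h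
        · rw [max_eq_left h]
          have e : (S x - M * b x) ^ 2 / (M ^ 2 * (2 * η)) + η / 2 - (b x - S x / M) =
              (S x / M - b x + η) ^ 2 / (2 * η) := by
            field_simp; ring
          have : 0 ≤ (S x / M - b x + η) ^ 2 / (2 * η) := by positivity
          linarith
        · rw [max_eq_right h, div_self (hM0.trans_le h).ne']
          have : 0 ≤ (S x - M * b x) ^ 2 / (M ^ 2 * (2 * η)) + η / 2 := by positivity
          linarith [hb1 x]
      have := mul_le_mul_of_nonneg_left hpt' (hw x)
      calc _ = w x * (b x - ((S x - M * b x) ^ 2 / (M ^ 2 * (2 * η)) + η / 2)) := by ring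
        _ ≤ w x * (S x / max (M : ℝ) (S x)) := this
        _ = _ := by ring
    have hsq : (∑ x, w x * (S x - M * b x) ^ 2) / (M ^ 2 * (2 * η)) ≤ η / 2 := by
      rw [div_le_iff₀ (by positivity)]
      rw [div_le_iff₀ (by positivity)] at hM
      calc _ ≤ M * exp L := hJ
        _ ≤ M * (M * η ^ 2) := mul_le_mul_of_nonneg_left hM hM0.le
        _ = _ := by ring
    calc 1 - 2 * η ≤ ∑ x, w x * b x - ((∑ x, w x * (S x - M * b x) ^ 2) / (M ^ 2 * (2 * η))
          + 1 * (η / 2)) := by linarith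
      _ = ∑ x, (w x * b x -
          (w x * (S x - M * b x) ^ 2 / (M ^ 2 * (2 * η)) + w x * (η / 2))) := by
          rw [Finset.sum_sub_distrib, Finset.sum_add_distrib, Finset.sum_div, ← Finset.sum_mul,
            hw1]
      _ ≤ _ := Finset.sum_le_sum fun x _ => hpt x

/-- A mixture with bounded mutual information can be rearranged into one with few terms, all of
which but one have a small density with respect to a term of the original mixture. -/
lemma exists_short_mixture {w : X → ℝ} (hw : 0 ≤ w) (hw1 : ∑ x, w x = 1) {p : κ → ℝ}
    (hp : ∀ j, 0 < p j) (hp1 : ∑ j, p j = 1) {q : κ → X → ℝ} (hq : ∀ j, 0 ≤ q j)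
    (hq1 : ∀ j, ∑ x, q j x = 1) (hpq : ∀ x, ∑ j, p j * q j x = w x) {I : ℝ} (hI0 : 0 ≤ I)
    (hI : ∑ j, p j * ∑ x, q j x * (log (q j x) - log (w x)) ≤ I) {η δ : ℝ} (hη : 0 < η)
    (hδ : 0 < δ) {M : ℕ} (hM : exp (2 + I / η) / η ^ 2 ≤ M) :
    ∃ (t : Fin (M + 1) → ℝ) (ν : Fin (M + 1) → X → ℝ), (∀ k, 0 ≤ t k) ∧ ∑ k, t k = 1 ∧
      (∀ k, 0 ≤ ν k) ∧ (∀ k, ∑ x, ν k x = 1) ∧ (∀ x, ∑ k, t k * ν k x = w x) ∧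
      t 0 ≤ 2 * η * (1 + 1 / δ) ∧
      ∀ k, k ≠ 0 → ∃ j, ∀ x, ν k x ≤ (1 + δ) * q j x := by
  classical
  have hM0 : (0 : ℝ) < M := (div_pos (exp_pos _) (pow_pos hη 2)).trans_le hM
  obtain ⟨J, h, hh0, hhq, hhw, hhm⟩ := exists_subpieces hw hw1 hp hp1 hq hq1 hpq hI0 hI hη hM
  set s : Fin M → ℝ := fun k => ∑ x, h k x with hs
  have hs0 : ∀ k, 0 ≤ s k := fun k => Finset.sum_nonneg fun x _ => hh0 k x
  have hs1 : ∀ k, s k ≤ 1 / M := fun k => by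
    rw [le_div_iff₀ hM0, mul_comm, hs, Finset.mul_sum, ← hq1 (J k)]
    exact Finset.sum_le_sum fun x _ => hhq k x
  -- Each h k has mass at most 1/M. A piece is kept if its mass is within the factor 1 + δ of that,
  -- so normalising it gives density at most 1 + δ; a rejected piece gets weight zero and the filler
  -- law q (J k).
  set G : Fin M → Prop := fun k => 1 ≤ M * s k * (1 + δ) with hG
  have hGs : ∀ k, G k → 0 < s k := fun k hk => by
    refine (hs0 k).lt_of_ne fun h0 => ?_
    simp only [hG, ← h0, mul_zero, zero_mul] at hk
    linarith
  set T : Fin M → ℝ := fun k => if G k then s k else 0 with hT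
  set N : Fin M → X → ℝ := fun k => if G k then (s k)⁻¹ • h k else q (J k) with hN
  have hT0 : ∀ k, 0 ≤ T k := fun k => by
    simp only [hT]; split_ifs; exacts [hs0 k, le_rfl]
  have hTN : ∀ k x, T k * N k x ≤ h k x := fun k x => by
    simp only [hT, hN]; split_ifs with hk
    · simp [(hGs k hk).ne']
    · simpa using hh0 k x
  have hN0 : ∀ k, 0 ≤ N k := fun k => by
    simp only [hN]; split_ifs
    · exact smul_nonneg (inv_nonneg.2 (hs0 k)) (hh0 k)
    · exact hq _
  have hN1 : ∀ k, ∑ x, N k x = 1 := fun k => by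
    simp only [hN]; split_ifs with hk
    · simp only [Pi.smul_apply, smul_eq_mul, ← Finset.mul_sum]
      exact inv_mul_cancel₀ (hGs k hk).ne'
    · exact hq1 _
  have hNq : ∀ k x, N k x ≤ (1 + δ) * q (J k) x := fun k x => by
    simp only [hN]; split_ifs with hk
    · have h1 : 1 ≤ M * s k * (1 + δ) := hk
      rw [Pi.smul_apply, smul_eq_mul, inv_mul_le_iff₀ (hGs k hk)]
      calc h k x ≤ M * s k * (1 + δ) * h k x := le_mul_of_one_le_left (hh0 k x) h1
        _ = s k * (1 + δ) * (M * h k x) := by ring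
        _ ≤ s k * (1 + δ) * q (J k) x :=
          mul_le_mul_of_nonneg_left (hhq k x) (mul_nonneg (hs0 k) (by linarith))
        _ = _ := by ring
    · exact le_mul_of_one_le_left (hq _ x) (by linarith)
  set ρ : X → ℝ := fun x => w x - ∑ k, T k * N k x with hρ
  have hρ0 : 0 ≤ ρ := fun x => sub_nonneg.2
    ((Finset.sum_le_sum fun k _ => hTN k x).trans (hhw x))
  have hρs : ∑ x, ρ x = 1 - ∑ k, T k := by
    simp only [hρ, Finset.sum_sub_distrib, hw1]
    rw [Finset.sum_comm]
    simp only [← Finset.mul_sum, hN1, mul_one]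
  set t0 := 1 - ∑ k, T k with ht0
  have ht00 : 0 ≤ t0 := hρs ▸ Finset.sum_nonneg fun x _ => hρ0 x
  set N0 : X → ℝ := if t0 = 0 then w else t0⁻¹ • ρ with hN0'
  have ht0N0 : ∀ x, t0 * N0 x = ρ x := fun x => by
    simp only [hN0']; split_ifs with hz
    · rw [hz] at hρs
      rw [hz, zero_mul, (Finset.sum_eq_zero_iff_of_nonneg fun x _ => hρ0 x).1 hρs x (mem_univ x)]
    · simp [hz]
  refine ⟨Fin.cons t0 T, Fin.cons (α := fun _ => X → ℝ) N0 N, ?_, ?_, ?_, ?_, ?_, ?_, ?_⟩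
  · exact fun k => Fin.cases (by simpa using ht00) (fun k => by simpa using hT0 k) k
  · rw [Fin.sum_univ_succ]; simp [ht0]
  · refine fun k => Fin.cases ?_ (fun k => by simpa using hN0 k) k
    simp only [Fin.cons_zero, hN0']; split_ifs
    · exact hw
    · exact smul_nonneg (inv_nonneg.2 ht00) hρ0
  · refine fun k => Fin.cases ?_ (fun k => by simpa using hN1 k) k
    simp only [Fin.cons_zero, hN0']; split_ifs with hz
    · exact hw1
    · simp only [Pi.smul_apply, smul_eq_mul, ← Finset.mul_sum, hρs]
      exact inv_mul_cancel₀ hz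
  · intro x
    rw [Fin.sum_univ_succ]
    simp only [Fin.cons_zero, Fin.cons_succ, ht0N0, hρ]
    ring
  · rw [Fin.cons_zero]
    -- A rejected mass s satisfies δ s ≤ 1/M − s. The total deficit is at most 2η, so rejection
    -- loses at most a further 2η/δ.
    have hbad : ∀ k, s k - T k ≤ (1 / δ) * (1 / M - s k) := fun k => by
      have h1 := hs1 k
      simp only [hT]; split_ifs with hk
      · rw [sub_self]
        exact mul_nonneg (by positivity) (by linarith)
      · simp only [hG, not_le] at hk
        rw [sub_zero, one_div_mul_eq_div, le_div_iff₀ hδ, le_sub_iff_add_le, le_div_iff₀ hM0]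
        linarith
    have h1 := Finset.sum_le_sum fun k (_ : k ∈ univ) => hbad k
    rw [Finset.sum_sub_distrib, ← Finset.mul_sum, Finset.sum_sub_distrib, Finset.sum_const,
      Finset.card_univ, Fintype.card_fin, nsmul_eq_mul, mul_one_div_cancel hM0.ne'] at h1
    have h2 : (1 / δ) * (1 - ∑ k, s k) ≤ (1 / δ) * (2 * η) :=
      mul_le_mul_of_nonneg_left (by linarith) (by positivity)
    linarith
  · refine fun k => Fin.cases (fun h => absurd rfl h) (fun k _ => ⟨J k, fun x => ?_⟩) k
    simpa using hNq k x

end Sampling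

/-! ### Transport duality by separation of convex sets -/

section Kantorovich

variable {K : Type*} [Fintype K]

lemma clm_pi_apply [DecidableEq K] (F : (K → ℝ) →L[ℝ] ℝ) (x : K → ℝ) :
    F x = ∑ i, x i * F (Pi.single i 1) := by
  conv_lhs => rw [pi_eq_sum_univ' x, map_sum]
  refine Finset.sum_congr rfl fun i _ => ?_
  rw [map_smul, smul_eq_mul]

/-- Kantorovich duality on a finite set. -/
lemma exists_coupling {d : K → K → ℝ} (hd : ∀ x y z, d x z ≤ d x y + d y z)
    (hd0 : ∀ x, d x x = 0) {ν w : K → ℝ} (hν : 0 ≤ ν) (hν1 : ∑ x, ν x = 1) (hw : 0 ≤ w)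
    (hw1 : ∑ x, w x = 1) {W : ℝ}
    (h : ∀ f : K → ℝ, (∀ x y, f x - f y ≤ d x y) → ∑ x, ν x * f x - ∑ x, w x * f x ≤ W) :
    ∃ γ : K × K → ℝ, 0 ≤ γ ∧ (∀ x, ∑ y, γ (x, y) = ν x) ∧ (∀ y, ∑ x, γ (x, y) = w y) ∧
      ∑ q, γ q * d q.1 q.2 ≤ W := by
  classical
  let T : (K × K → ℝ) →ₗ[ℝ] (K → ℝ) × (K → ℝ) × ℝ :=
    { toFun := fun γ => (fun x => ∑ y, γ (x, y), fun y => ∑ x, γ (x, y), ∑ q, γ q * d q.1 q.2)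
      map_add' := fun γ γ' => by
        simp only [Pi.add_apply, Finset.sum_add_distrib, add_mul]; rfl
      map_smul' := fun s γ => by
        simp only [Pi.smul_apply, smul_eq_mul, ← Finset.mul_sum, mul_assoc]; rfl }
  have hTc : Continuous T := T.continuous_of_finiteDimensional
  by_contra! hcon
  -- If every coupling costs more than W, the compact set of triples (first marginal, second
  -- marginal, cost) misses {ν} × {w} × (−∞, W].
  have hdisj : Disjoint (T '' stdSimplex ℝ (K × K))
      (({ν} : Set (K → ℝ)) ×ˢ (({w} : Set (K → ℝ)) ×ˢ Set.Iic W)) := by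
    rw [Set.disjoint_left]
    rintro _ ⟨γ, hγ, rfl⟩ ⟨h1, h2, h3⟩
    exact absurd h3 (not_le.2 (hcon γ hγ.1 (fun x => congrFun h1 x) fun y => congrFun h2 y))
  obtain ⟨F, u, v, hFu, huv, hFv⟩ := geometric_hahn_banach_compact_closed
    ((convex_stdSimplex ℝ (K × K)).linear_image T) ((isCompact_stdSimplex ℝ (K × K)).image hTc)
    ((convex_singleton ν).prod ((convex_singleton w).prod (convex_Iic W)))
    (isClosed_singleton.prod (isClosed_singleton.prod isClosed_Iic)) hdisj
  set α : K → ℝ := fun x => F (Pi.single x 1, 0, 0) with hα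
  set β : K → ℝ := fun y => F (0, Pi.single y 1, 0) with hβ
  set c : ℝ := F (0, 0, 1) with hc
  have hF : ∀ a b t, F (a, b, t) = ∑ x, a x * α x + ∑ y, b y * β y + t * c := fun a b t => by
    have e1 := clm_pi_apply (F.comp (ContinuousLinearMap.inl ℝ (K → ℝ) ((K → ℝ) × ℝ))) a
    have e2 := clm_pi_apply (F.comp ((ContinuousLinearMap.inr ℝ (K → ℝ) ((K → ℝ) × ℝ)).comp
      (ContinuousLinearMap.inl ℝ (K → ℝ) ℝ))) b
    simp only [ContinuousLinearMap.comp_apply, ContinuousLinearMap.inl_apply,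
      ContinuousLinearMap.inr_apply] at e1 e2
    have e3 : F (0, 0, t) = t * c := by
      rw [hc, ← smul_eq_mul, ← map_smul]; simp
    have e : ((a, b, t) : (K → ℝ) × (K → ℝ) × ℝ) = (a, 0, 0) + (0, b, 0) + (0, 0, t) := by simp
    rw [e, map_add, map_add, e3]
    exact congrArg₂ _ (congrArg₂ _ e1 e2) rfl
  have hle : ∀ x y, α x + β y + d x y * c < u := fun x y => by
    have := hFu _ ⟨_, single_mem_stdSimplex ℝ (x, y), rfl⟩
    have e : T (Pi.single (x, y) 1) = (Pi.single x 1, Pi.single y 1, d x y) := by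
      refine Prod.ext ?_ (Prod.ext ?_ ?_)
      · ext x'
        by_cases hx : x' = x
        · subst hx
          simpa [T, Pi.single_apply] using Finset.card_eq_one.2 ⟨y, by ext; simp⟩
        · simp [T, Pi.single_apply, hx]
      · ext y'
        by_cases hy : y' = y
        · subst hy
          simpa [T, Pi.single_apply] using Finset.card_eq_one.2 ⟨x, by ext; simp⟩
        · simp [T, Pi.single_apply, hy]
      · simp [T, Pi.single_apply]
    rw [e, hF] at this
    simpa [Pi.single_apply] using this
  have hge : ∀ s ≤ W, v < ∑ x, ν x * α x + ∑ y, w y * β y + s * c := fun s hs => by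
    rw [← hF]; exact hFv _ ⟨rfl, rfl, hs⟩
  set P := ∑ x, ν x * α x + ∑ y, w y * β y with hP
  -- The separated ray is unbounded below in the cost, which forces the sign.
  have hc0 : c ≤ 0 := by
    by_contra! hcpos
    have := hge (min W ((v - P) / c)) (min_le_left _ _)
    have h2 : min W ((v - P) / c) * c ≤ (v - P) / c * c :=
      mul_le_mul_of_nonneg_right (min_le_right _ _) hcpos.le
    rw [div_mul_cancel₀ _ hcpos.ne'] at h2
    linarith
  have hK : Nonempty K := by
    by_contra hne
    rw [not_nonempty_iff] at hne
    simp at hν1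
  -- This infimal transform of β replaces the pair of potentials by a single function, Lipschitz
  -- with constant −c by the triangle inequality.
  set φ : K → ℝ := fun x => univ.inf' univ_nonempty fun y => u - β y - d x y * c with hφ
  have hφle : ∀ x y, φ x ≤ u - β y - d x y * c := fun x y =>
    Finset.inf'_le (fun y => u - β y - d x y * c) (mem_univ y)
  have hαφ : ∀ x, α x ≤ φ x := fun x =>
    Finset.le_inf' _ _ fun y _ => by linarith [hle x y]
  have hφβ : ∀ x, φ x ≤ u - β x := fun x => by
    have := hφle x x
    rw [hd0] at this; linarith
  have hφlip : ∀ x z, φ x - φ z ≤ -c * d x z := fun x z => by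
    obtain ⟨y, -, hy⟩ := Finset.exists_mem_eq_inf' univ_nonempty fun y => u - β y - d z y * c
    have h1 := hφle x y
    have h2 : φ z = u - β y - d z y * c := hy
    have h3 := mul_le_mul_of_nonneg_left (hd x z y) (neg_nonneg.2 hc0)
    rw [h2]
    linarith
  have h1 : ∑ x, ν x * α x ≤ ∑ x, ν x * φ x :=
    Finset.sum_le_sum fun x _ => mul_le_mul_of_nonneg_left (hαφ x) (hν x)
  have h2 : ∑ x, w x * φ x ≤ u - ∑ x, w x * β x := by
    calc ∑ x, w x * φ x ≤ ∑ x, w x * (u - β x) :=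
          Finset.sum_le_sum fun x _ => mul_le_mul_of_nonneg_left (hφβ x) (hw x)
      _ = _ := by simp only [mul_sub, Finset.sum_sub_distrib, ← Finset.sum_mul, hw1, one_mul]
  have h3 : ∑ x, ν x * φ x - ∑ x, w x * φ x ≤ -c * W := by
    -- When c = 0 the function φ is constant; otherwise φ / (−c) is an admissible test function.
    rcases hc0.eq_or_lt with h0 | h0
    · obtain ⟨z⟩ := hK
      have hconst : ∀ x, φ x = φ z := fun x => by
        have a1 := hφlip x z
        have a2 := hφlip z x
        rw [h0] at a1 a2
        linarith
      simp only [hconst, ← Finset.sum_mul, hν1, hw1, h0]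
      simp
    · have := h (fun x => φ x / -c) fun x y => by
        rw [← sub_div, div_le_iff₀ (neg_pos.2 h0)]
        linarith [hφlip x y]
      simp only [← mul_div_assoc, ← Finset.sum_div] at this
      rw [← sub_div, div_le_iff₀ (neg_pos.2 h0)] at this
      linarith
  have h4 := hge W le_rfl
  linarith

end Kantorovich

/-! ### From exponential moments to the transport inequality -/

section Measures

variable {X : Type*} [Fintype X] [MeasurableSpace X] [DiscreteMeasurableSpace X]

/-- The measure on a finite set with the given weights. -/
noncomputable def ofWeights (w : X → ℝ) : Measure X :=
  ∑ x, ENNReal.ofReal (w x) • Measure.dirac x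

lemma ofWeights_apply (w : X → ℝ) (s : Set X) [DecidablePred (· ∈ s)] :
    ofWeights w s = ∑ x with x ∈ s, ENNReal.ofReal (w x) := by
  simp [ofWeights, Measure.finsetSum_apply, Set.indicator_apply, Finset.sum_filter]

lemma ofWeights_singleton (w : X → ℝ) (x : X) : ofWeights w {x} = ENNReal.ofReal (w x) := by
  classical
  rw [ofWeights_apply, ← Finset.sum_singleton (fun y => ENNReal.ofReal (w y)) x]
  exact Finset.sum_congr (by ext; simp) fun _ _ => rfl

instance (w : X → ℝ) : IsFiniteMeasure (ofWeights w) := by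
  classical
  refine ⟨?_⟩
  rw [ofWeights_apply]
  exact ENNReal.sum_lt_top.2 fun _ _ => ENNReal.ofReal_lt_top

lemma isProbabilityMeasure_ofWeights {w : X → ℝ} (hw : 0 ≤ w) (hw1 : ∑ x, w x = 1) :
    IsProbabilityMeasure (ofWeights w) := by
  classical
  refine ⟨?_⟩
  rw [ofWeights_apply]
  simp [← ENNReal.ofReal_sum_of_nonneg fun x _ => hw x, hw1]

lemma measureReal_ofWeights {w : X → ℝ} (hw : 0 ≤ w) (x : X) : (ofWeights w).real {x} = w x := by
  rw [measureReal_def, ofWeights_singleton, ENNReal.toReal_ofReal (hw x)]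

lemma integral_eq_sum (μ : Measure X) [IsFiniteMeasure μ] (f : X → ℝ) :
    ∫ x, f x ∂μ = ∑ x, μ.real {x} * f x := by
  rw [integral_fintype .of_finite]; rfl

lemma sum_measureReal (μ : Measure X) [IsProbabilityMeasure μ] : ∑ x, μ.real {x} = 1 := by
  simp [sum_measureReal_singleton]

/-- The Gibbs variational inequality. -/
lemma integral_sub_klDiv_le (μ ν : Measure X) [IsProbabilityMeasure μ] [IsProbabilityMeasure ν]
    (hfin : InformationTheory.klDiv ν μ ≠ ⊤) (f : X → ℝ) :
    ∫ x, f x ∂ν - (InformationTheory.klDiv ν μ).toReal ≤ log (∫ x, exp (f x) ∂μ) := by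
  obtain ⟨hac, hint⟩ := InformationTheory.klDiv_ne_top_iff.1 hfin
  have hexp : Integrable (fun x => exp (f x)) μ := .of_finite
  have hp := isProbabilityMeasure_tilted hexp
  -- The gap in the inequality is the divergence of ν from the tilted measure, which is nonnegative.
  have h1 := integral_llr_tilted_right hac (.of_finite (f := f)) hexp hint
  rw [InformationTheory.toReal_klDiv_of_measure_eq hac (by simp)]
  rw [← InformationTheory.toReal_klDiv_of_measure_eq
    (hac.trans (absolutelyContinuous_tilted hexp)) (by simp)] at h1
  have := ENNReal.toReal_nonneg (a := InformationTheory.klDiv ν (μ.tilted f))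
  linarith

/-- The Bobkov--Götze criterion: exponential moments of Lipschitz functions control transport. -/
lemma tInequality_of_exp_moment {d : X → X → ℝ} (hd : ∀ x y z, d x z ≤ d x y + d y z)
    (hd0 : ∀ x, d x x = 0) (hdn : ∀ x y, 0 ≤ d x y) {w : X → ℝ} (hw : 0 ≤ w)
    (hw1 : ∑ x, w x = 1) {κ r : ℝ} (hκ : 0 < κ) (hr : 0 ≤ r)
    (h : ∀ f : X → ℝ, (∀ x y, f x - f y ≤ d x y) →
      ∑ x, w x * exp (κ * f x) ≤ exp (κ * (∑ x, w x * f x + r))) :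
    TInequality d (ofWeights w) κ r := by
  intro ν hν
  have hP := isProbabilityMeasure_ofWeights hw hw1
  by_cases hfin : InformationTheory.klDiv ν (ofWeights w) = ⊤
  · simp [hfin, ENNReal.top_div_of_ne_top]
  set D := (InformationTheory.klDiv ν (ofWeights w)).toReal with hD
  have hdual : ∀ f : X → ℝ, (∀ x y, f x - f y ≤ d x y) →
      ∑ x, ν.real {x} * f x - ∑ x, w x * f x ≤ D / κ + r := fun f hf => by
    have h1 := integral_sub_klDiv_le (ofWeights w) ν hfin fun x => κ * f x
    simp only [integral_eq_sum, measureReal_ofWeights hw] at h1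
    have hpos : 0 < ∑ x, w x * exp (κ * f x) := by
      have := integral_exp_pos (μ := ofWeights w) (f := fun x => κ * f x) .of_finite
      simpa only [integral_eq_sum, measureReal_ofWeights hw] using this
    have h2 := h1.trans ((log_le_iff_le_exp hpos).2 (h f hf))
    have e : ∑ x, ν.real {x} * (κ * f x) = κ * ∑ x, ν.real {x} * f x := by
      rw [Finset.mul_sum]; exact Finset.sum_congr rfl fun x _ => by ring
    rw [e] at h2
    have e2 : D / κ + r = (D + κ * r) / κ := by field_simp
    rw [e2, le_div_iff₀ hκ]
    linarith
  obtain ⟨γ, hγ, hγ1, hγ2, hγd⟩ := exists_coupling hd hd0 (fun x => measureReal_nonneg)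
    (sum_measureReal ν) hw hw1 hdual
  have hle : transportDist d ν (ofWeights w) ≤ D / κ + r := by
    refine csInf_le_of_le ⟨0, ?_⟩ ⟨ofWeights γ, ⟨?_, ?_⟩, rfl⟩ ?_
    · rintro _ ⟨γ', -, rfl⟩
      exact integral_nonneg fun q => hdn _ _
    · classical
      refine Measure.ext_iff_singleton.2 fun x => ?_
      rw [Measure.map_apply measurable_fst (measurableSet_singleton x), ofWeights_apply,
        ← ENNReal.ofReal_sum_of_nonneg fun q _ => hγ q, ← ofReal_measureReal, ← hγ1 x]
      congr 1
      rw [Finset.sum_filter, Fintype.sum_prod_type]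
      simp only [Set.mem_preimage, Set.mem_singleton_iff]
      rw [Finset.sum_eq_single x (fun b _ hb => by simp [hb]) (by simp)]
      simp
    · classical
      refine Measure.ext_iff_singleton.2 fun y => ?_
      rw [Measure.map_apply measurable_snd (measurableSet_singleton y), ofWeights_apply,
        ← ENNReal.ofReal_sum_of_nonneg fun q _ => hγ q, ofWeights_singleton, ← hγ2 y]
      congr 1
      rw [Finset.sum_filter, Fintype.sum_prod_type]
      simp
    · rwa [integral_eq_sum, Finset.sum_congr rfl fun q _ => by rw [measureReal_ofWeights hγ q]]
  calc ENNReal.ofReal (transportDist d ν (ofWeights w)) ≤ ENNReal.ofReal (D / κ + r) :=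
        ENNReal.ofReal_le_ofReal hle
    _ = _ := by
        rw [ENNReal.ofReal_add (div_nonneg ENNReal.toReal_nonneg hκ.le) hr,
          ENNReal.ofReal_div_of_pos hκ, ENNReal.ofReal_toReal hfin]

end Measures

/-! ### Stability under densities close to one -/

section Stability

variable {X : Type*} [Fintype X]

/-- Exponential moment bounds are stable under passing to a measure with density close to one. -/
lemma exp_moment_of_le {d : X → X → ℝ} (hd1 : ∀ x y, d x y ≤ 1) {q ν : X → ℝ}
    (hq : 0 ≤ q) (hq1 : ∑ x, q x = 1) (hν1 : ∑ x, ν x = 1) {δ κ r r' : ℝ} (hδ : 0 ≤ δ) (hκ : 0 < κ)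
    (hle : ∀ x, ν x ≤ (1 + δ) * q x) (hr : δ + κ * δ + κ * r' ≤ κ * r) {f : X → ℝ}
    (hf : ∀ x y, f x - f y ≤ d x y)
    (h : ∑ x, q x * exp (κ * f x) ≤ exp (κ * (∑ x, q x * f x + r'))) :
    ∑ x, ν x * exp (κ * f x) ≤ exp (κ * (∑ x, ν x * f x + r)) := by
  have hX : Nonempty X := by
    by_contra hne
    rw [not_nonempty_iff] at hne
    simp at hq1
  obtain ⟨z, hz⟩ := Finite.exists_max f
  -- Measured down from its maximum, f takes values in [0, 1], so the density bound limits the drop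
  -- of its mean to δ.
  have hmean : ∑ x, q x * f x ≤ ∑ x, ν x * f x + δ := by
    have h1 : ∀ x, ν x * (f z - f x) ≤ q x * (f z - f x) + δ * q x := fun x => by
      have a1 := mul_le_mul_of_nonneg_right (hle x) (sub_nonneg.2 (hz x))
      have a2 := mul_le_mul_of_nonneg_left ((hf z x).trans (hd1 z x)) (mul_nonneg hδ (hq x))
      linarith
    have h2 := Finset.sum_le_sum fun x (_ : x ∈ univ) => h1 x
    simp only [mul_sub, Finset.sum_add_distrib, Finset.sum_sub_distrib, ← Finset.sum_mul,
      ← Finset.mul_sum, hq1, hν1] at h2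
    linarith
  calc ∑ x, ν x * exp (κ * f x) ≤ ∑ x, (1 + δ) * (q x * exp (κ * f x)) :=
        Finset.sum_le_sum fun x _ => by
          rw [← mul_assoc]
          exact mul_le_mul_of_nonneg_right (hle x) (exp_pos _).le
    _ = (1 + δ) * ∑ x, q x * exp (κ * f x) := by rw [Finset.mul_sum]
    _ ≤ exp δ * exp (κ * (∑ x, q x * f x + r')) :=
        mul_le_mul (by linarith [add_one_le_exp δ]) h
          (Finset.sum_nonneg fun x _ => mul_nonneg (hq x) (exp_pos _).le) (exp_pos _).le
    _ ≤ exp (κ * (∑ x, ν x * f x + r)) := by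
        rw [← exp_add, exp_le_exp]
        have := mul_le_mul_of_nonneg_left hmean hκ.le
        linarith

end Stability

/-! ### Identification with the measure-theoretic entropies -/

section Entropy

variable {A : Type*} [Fintype A] [MeasurableSpace A] [DiscreteMeasurableSpace A] {n : ℕ}

/-- Each fibre of `drop i` is parametrised by the i-th coordinate; normalising by its mass
contributes the logarithm that becomes the entropy of the pushforward. -/
lemma condShannonEntropy_eq (μ : Measure (Fin n → A)) [IsProbabilityMeasure μ] (i : Fin n) :
    condShannonEntropy μ (fun x : Fin n → A => x i)
      (fun (x : Fin n → A) (j : {j : Fin n // j ≠ i}) => x j) =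
      condEnt (drop i) fun x => μ.real {x} := by
  classical
  set w : (Fin n → A) → ℝ := fun x => μ.real {x} with hw
  have hfib : ∀ (z : {j : Fin n // j ≠ i} → A) (F : ℝ → ℝ),
      ∑ a, F (μ.real (drop i ⁻¹' {z} ∩ (fun x : Fin n → A => x i) ⁻¹' {a})) =
        ∑ x with drop i x = z, F (w x) := fun z F => by
    symm
    refine Finset.sum_bij (fun x _ => x i) (by simp) (fun x hx y hy hxy => ?_) (fun a _ => ?_)
      fun x hx => ?_
    · simp only [mem_filter, mem_univ, true_and] at hx hy
      ext j
      by_cases hj : j = i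
      · subst hj; exact hxy
      · exact (congrFun hx ⟨j, hj⟩).trans (congrFun hy ⟨j, hj⟩).symm
    · refine ⟨(Equiv.funSplitAt i A).symm (a, z), ?_, by simp⟩
      simp only [mem_filter, mem_univ, true_and]
      ext j
      simp [drop, j.2]
    · simp only [mem_filter, mem_univ, true_and] at hx
      have : drop i ⁻¹' {z} ∩ (fun y : Fin n → A => y i) ⁻¹' {x i} = {x} := by
        ext y
        simp only [Set.mem_inter_iff, Set.mem_preimage, Set.mem_singleton_iff]
        constructor
        · rintro ⟨h1, h2⟩
          ext j
          by_cases hj : j = i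
          · subst hj; exact h2
          · exact (congrFun h1 ⟨j, hj⟩).trans (congrFun hx ⟨j, hj⟩).symm
        · rintro rfl; exact ⟨hx, rfl⟩
      rw [this]
  have hpush : ∀ z, μ.real (drop i ⁻¹' {z}) = push (drop i) w z := fun z => by
    rw [push, hw, sum_measureReal_singleton]
    congr 1
    ext x; simp
  have hterm : ∀ z, μ.real (drop i ⁻¹' {z}) *
      shannonEntropy ((μ[|drop i ⁻¹' {z}]).map fun x => x i) =
      (∑ x with drop i x = z, negMulLog (w x)) - negMulLog (push (drop i) w z) := fun z => by
    have e : ∀ a, ((μ[|drop i ⁻¹' {z}]).map fun x => x i).real {a} =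
        (push (drop i) w z)⁻¹ *
          μ.real (drop i ⁻¹' {z} ∩ (fun x : Fin n → A => x i) ⁻¹' {a}) := fun a => by
      rw [map_measureReal_apply (measurable_pi_apply i) (measurableSet_singleton a),
        ← hpush, measureReal_def, cond_apply (.of_discrete), ENNReal.toReal_mul,
        ENNReal.toReal_inv]
      rfl
    rw [hpush, shannonEntropy]
    simp only [e]
    rw [hfib z fun t => negMulLog ((push (drop i) w z)⁻¹ * t)]
    by_cases h0 : push (drop i) w z = 0
    · have h1 := (Finset.sum_eq_zero_iff_of_nonneg
        fun x _ => (measureReal_nonneg : 0 ≤ w x)).1 h0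
      rw [h0, zero_mul, negMulLog_zero, Finset.sum_eq_zero, sub_zero]
      intro x hx
      rw [show w x = 0 from h1 x (by simpa using hx), negMulLog_zero]
    · have e2 : ∀ x, push (drop i) w z * negMulLog ((push (drop i) w z)⁻¹ * w x) =
          negMulLog (w x) + w x * log (push (drop i) w z) := fun x => by
        rw [negMulLog_mul, negMulLog, log_inv]
        field_simp
        ring
      rw [Finset.mul_sum]
      simp only [e2, Finset.sum_add_distrib, ← Finset.sum_mul]
      have e3 : ∑ x with drop i x = z, w x = push (drop i) w z := by
        rw [push]; congr
      rw [e3, negMulLog]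
      ring
  calc _ = ∑ z, μ.real (drop i ⁻¹' {z}) *
      shannonEntropy ((μ[|drop i ⁻¹' {z}]).map fun x => x i) := rfl
    _ = condEnt (drop i) w := by
      simp only [hterm]
      rw [Finset.sum_sub_distrib, Finset.sum_fiberwise]
      rfl

lemma condEnt_triv_eq (μ : Measure (Fin n → A)) [IsProbabilityMeasure μ] :
    condEnt triv (fun x => μ.real {x}) = shannonEntropy μ := by
  simp [condEnt, ent, push_triv, sum_measureReal_singleton, shannonEntropy]

lemma dualTotalCorrelation_eq (μ : Measure (Fin n → A)) [IsProbabilityMeasure μ] :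
    dualTotalCorrelation μ = condEnt triv (fun x => μ.real {x}) -
      ∑ i, condEnt (drop i) fun x => μ.real {x} := by
  rw [dualTotalCorrelation, condEnt_triv_eq]
  simp only [condShannonEntropy_eq]

lemma dualTotalCorrelation_nonneg (μ : Measure (Fin n → A)) [IsProbabilityMeasure μ] :
    0 ≤ dualTotalCorrelation μ := by
  rw [dualTotalCorrelation_eq]
  exact sub_nonneg.2 (sum_condEnt_drop_le fun _ => measureReal_nonneg)

end Entropy

/-! ### The tensorizing mixture and its mutual information -/

section Mixture

lemma condKL_smul_right {X Z : Type*} [Fintype X] (g : X → Z) {u w : X → ℝ} (hw : 0 ≤ w)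
    (h : ∀ x, w x = 0 → u x = 0) {c : ℝ} (hc : 0 < c) : condKL g u (c • w) = condKL g u w := by
  refine Finset.sum_congr rfl fun x _ => ?_
  rcases (hw x).eq_or_lt with h0 | h0
  · rw [h x h0.symm, zero_mul, zero_mul]
  simp only [Pi.zero_apply] at h0
  have hp := h0.trans_le (le_push hw g x)
  rw [push_smul, Pi.smul_apply, Pi.smul_apply, smul_eq_mul, smul_eq_mul, log_mul hc.ne' h0.ne',
    log_mul hc.ne' hp.ne']
  ring

variable {I A : Type*} [Fintype I] [DecidableEq I] [Fintype A]

/-- Every distribution is a mixture, with mutual information at most twice the dual total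
correlation, of distributions which satisfy approximate tensorization of entropy. -/
lemma exists_tensorizing_mixture {w : (I → A) → ℝ} (hw : 0 ≤ w) (hw1 : ∑ x, w x = 1) :
    ∃ (κ : Type) (_ : Fintype κ) (p : κ → ℝ) (q : κ → (I → A) → ℝ),
      (∀ j, 0 < p j) ∧ ∑ j, p j = 1 ∧ (∀ j, 0 ≤ q j) ∧ (∀ j, ∑ x, q j x = 1) ∧
      (∀ x, ∑ j, p j * q j x = w x) ∧
      ∑ j, p j * ∑ x, q j x * (log (q j x) - log (w x)) ≤
        2 * (condEnt triv w - ∑ i, condEnt (drop i) w) ∧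
      ∀ j, ∀ u : (I → A) → ℝ, 0 ≤ u → (∀ x, q j x = 0 → u x = 0) →
        condKL triv u (q j) ≤ 2 * ∑ i, condKL (drop i) u (q j) := by
  classical
  obtain ⟨W, hW, hpot, hAT⟩ := exists_optimal_decomps (fun i : I => drop (A := A) i) hw
  set κ := {j // W j ≠ 0} with hκ
  set p : Fin (Fintype.card (I → A) + 1) → ℝ := fun j => ∑ x, W j x with hp
  have hp0 : ∀ j : κ, 0 < p j := fun j => by
    have h0 : 0 ≤ p j := Finset.sum_nonneg fun x _ => hW.1 _ x
    refine h0.lt_of_ne fun h => j.2 ?_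
    ext x
    exact (Finset.sum_eq_zero_iff_of_nonneg fun x _ => hW.1 _ x).1 h.symm x (mem_univ x)
  -- Zero pieces cannot be normalised; they are discarded without affecting sums of functionals that
  -- vanish at 0.
  have hsub : ∀ F : ((I → A) → ℝ) → ℝ, F 0 = 0 → ∑ j : κ, F (W j) = ∑ j, F (W j) :=
    fun F hF => by
      rw [← Finset.sum_filter_add_sum_filter_not univ (fun j => W j ≠ 0),
        Finset.sum_eq_zero (s := univ.filter fun j => ¬ W j ≠ 0), add_zero]
      · exact (Finset.sum_subtype _ (by simp) fun j => F (W j)).symm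
      · intro j hj
        rw [not_not.1 (Finset.mem_filter.1 hj).2, hF]
  have hWx : ∀ x, ∑ j, W j x = w x := fun x => by
    rw [← hW.2, Finset.sum_apply]
  have hpW : ∀ (j : κ) x, p j * ((p j)⁻¹ * W j x) = W j x := fun j x => by
    rw [mul_inv_cancel_left₀ (hp0 j).ne']
  refine ⟨κ, inferInstance, fun j => p j, fun j => (p j)⁻¹ • W j, hp0, ?_, fun j =>
    smul_nonneg (inv_nonneg.2 (hp0 j).le) (hW.1 j), fun j => ?_, fun x => ?_, ?_,
    fun j u hu huq => ?_⟩
  · rw [hsub (fun v => ∑ x, v x) (by simp), Finset.sum_comm, ← hw1]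
    exact Finset.sum_congr rfl fun x _ => hWx x
  · simp only [Pi.smul_apply, smul_eq_mul, ← Finset.mul_sum]
    exact inv_mul_cancel₀ (hp0 j).ne'
  · simp only [Pi.smul_apply, smul_eq_mul, hpW]
    rw [hsub (fun v => v x) rfl, hWx]
  · have e : ∀ j : κ, p j * ∑ x, ((p j)⁻¹ • W j) x *
        (log (((p j)⁻¹ • W j) x) - log (w x)) =
        -condEnt triv (W j) - ∑ x, W j x * log (w x) := fun j => by
      rw [condEnt_eq, Finset.mul_sum, ← Finset.sum_neg_distrib, ← Finset.sum_sub_distrib]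
      refine Finset.sum_congr rfl fun x _ => ?_
      simp only [push_triv, Pi.smul_apply, smul_eq_mul]
      rw [← mul_assoc, hpW]
      by_cases h0 : W j x = 0
      · simp [h0]
      · rw [log_mul (inv_pos.2 (hp0 j)).ne' h0, log_inv]; ring
    simp only [e]
    rw [hsub (fun v => -condEnt triv v - ∑ x, v x * log (w x))
      (by simpa using condEnt_smul triv 0 (0 : (I → A) → ℝ)), Finset.sum_sub_distrib,
      Finset.sum_neg_distrib, Finset.sum_comm]
    simp only [← Finset.sum_mul, hWx]
    have e2 : condEnt triv w = -∑ x, w x * log (w x) := by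
      rw [condEnt_eq, ← Finset.sum_neg_distrib]
      refine Finset.sum_congr rfl fun x _ => ?_
      rw [push_triv, hw1, log_one]; ring
    -- Han's inequality for each piece; together with the optimality bound it gives information at
    -- most 2 DTC.
    have e3 : -((∑ j, condEnt triv (W j)) / 2) ≤ ∑ j, pot (fun i : I => drop (A := A) i) (W j) := by
      rw [Finset.sum_div, ← Finset.sum_neg_distrib]
      refine Finset.sum_le_sum fun j _ => ?_
      have := sum_condEnt_drop_le (hW.1 j)
      rw [pot]; linarith
    have e4 := e3.trans hpot
    rw [pot] at e4
    linarith
  · have hWu : ∀ x, W j x = 0 → u x = 0 := fun x hx => huq x (by simp [hx])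
    have hc := inv_pos.2 (hp0 j)
    rw [condKL_smul_right triv (hW.1 j) hWu hc,
      Finset.sum_congr rfl fun i _ => condKL_smul_right (drop i) (hW.1 j) hWu hc]
    exact hAT j u hu hWu

end Mixture

/-! ### Transport inequalities for the Hamming metric -/

section Hamming

variable {A : Type*} [DecidableEq A] {n : ℕ}

lemma normHamming_triangle (x y z : Fin n → A) :
    normHamming x z ≤ normHamming x y + normHamming y z := by
  rw [normHamming, normHamming, normHamming, ← add_div]
  exact div_le_div_of_nonneg_right (by exact_mod_cast hammingDist_triangle x y z) n.cast_nonneg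

lemma normHamming_self (x : Fin n → A) : normHamming x x = 0 := by simp [normHamming]

lemma normHamming_nonneg (x y : Fin n → A) : 0 ≤ normHamming x y := by
  unfold normHamming; positivity

lemma normHamming_le_one (x y : Fin n → A) : normHamming x y ≤ 1 := by
  refine div_le_one_of_le₀ ?_ n.cast_nonneg
  exact_mod_cast (hammingDist_le_card_fintype (x := x) (y := y)).trans_eq (Fintype.card_fin n)

lemma normHamming_le_of_drop_eq (i : Fin n) (x y : Fin n → A) (h : drop i x = drop i y) :
    normHamming x y ≤ 1 / n := by
  refine div_le_div_of_nonneg_right ?_ n.cast_nonneg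
  have : hammingDist x y ≤ 1 := by
    refine (Finset.card_le_card (t := {i}) fun j hj => ?_).trans_eq (card_singleton i)
    by_contra hji
    exact (Finset.mem_filter.1 hj).2 (congrFun h ⟨j, by simpa using hji⟩)
  exact_mod_cast this

variable [Fintype A] [MeasurableSpace A] [DiscreteMeasurableSpace A]

/-- For `r ≥ 1` the transport inequality holds trivially. -/
lemma tInequality_of_one_le {μ : Measure (Fin n → A)} [IsProbabilityMeasure μ] {κ r : ℝ}
    (hκ : 0 < κ) (hr : 1 ≤ r) : TInequality normHamming μ κ r := by
  have hμ : μ = ofWeights fun x => μ.real {x} :=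
    Measure.ext_iff_singleton.2 fun x => by rw [ofWeights_singleton, ofReal_measureReal]
  rw [hμ]
  have hsum := sum_measureReal μ
  refine tInequality_of_exp_moment normHamming_triangle normHamming_self normHamming_nonneg
    (fun _ => measureReal_nonneg) hsum hκ (by linarith) fun f hf => ?_
  have hz : ∀ z, f z ≤ ∑ x, μ.real {x} * f x + r := fun z => by
    have h1 : ∑ x, μ.real {x} * f z ≤ ∑ x, μ.real {x} * (f x + 1) :=
      Finset.sum_le_sum fun x _ => mul_le_mul_of_nonneg_left
        (by linarith [(hf z x).trans (normHamming_le_one z x)]) measureReal_nonneg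
    simp only [mul_add, Finset.sum_add_distrib, ← Finset.sum_mul, hsum] at h1
    linarith
  calc ∑ x, μ.real {x} * exp (κ * f x)
      ≤ ∑ x, μ.real {x} * exp (κ * (∑ x, μ.real {x} * f x + r)) :=
        Finset.sum_le_sum fun x _ => mul_le_mul_of_nonneg_left
          (exp_le_exp.2 (mul_le_mul_of_nonneg_left (hz x) hκ.le)) measureReal_nonneg
    _ = _ := by rw [← Finset.sum_mul, hsum, one_mul]

/-- Distributions with small density with respect to one satisfying approximate tensorization of
entropy satisfy a transport inequality. -/
lemma tInequality_of_tensorizing (hn : 0 < n) {q ν : (Fin n → A) → ℝ} (hq : 0 ≤ q)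
    (hq1 : ∑ x, q x = 1)
    (hAT : ∀ u : (Fin n → A) → ℝ, 0 ≤ u → (∀ x, q x = 0 → u x = 0) →
      condKL triv u q ≤ 2 * ∑ i, condKL (drop i) u q)
    (hν : 0 ≤ ν) (hν1 : ∑ x, ν x = 1) {δ r : ℝ} (hδ : 0 ≤ δ) (hr : 0 < r) (hr' : r ≤ 600)
    (hle : ∀ x, ν x ≤ (1 + δ) * q x) (hδr : δ * (600 + r) ≤ r ^ 2 / 2) :
    TInequality normHamming (ofWeights ν) (r * n / 600) r := by
  have hn' : (1 : ℝ) ≤ n := by exact_mod_cast hn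
  have hκ : 0 < r * n / 600 := by positivity
  refine tInequality_of_exp_moment normHamming_triangle normHamming_self normHamming_nonneg
    hν hν1 hκ hr.le fun f hf => ?_
  have hH := sum_mul_exp_le (fun i : Fin n => drop (A := A) i) hq hq1 hAT (f := f) (n := n)
    (by linarith) (by simp) (fun i x y h => (hf x y).trans (normHamming_le_of_drop_eq i x y h)) hκ
    (by nlinarith)
  refine exp_moment_of_le normHamming_le_one hq hq1 hν1 hδ hκ hle ?_ hf hH
  -- Herbst's error is only r/300. The losses from δ use at most half of the allowance κ r, because
  -- δ (600 + r) ≤ r²/2 and n ≥ 1.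
  have e : 2 * (r * n / 600) / n = r / 300 := by field_simp; norm_num
  rw [e]
  have h1 : δ * 600 ≤ n * (δ * 600) := le_mul_of_one_le_left (by positivity) hn'
  have h2 := mul_le_mul_of_nonneg_left hδr (by linarith : (0 : ℝ) ≤ n)
  have h3 : 0 ≤ r ^ 2 * n := by positivity
  nlinarith

end Hamming

/-- The summand 2 of the constant absorbs the rounding and the exceptional term; 2/η serves in the
exponent. -/
lemma ceil_exp_add_one_le {D η : ℝ} (hD : 0 ≤ D) (hη : 0 < η) :
    (((⌈exp (2 + 2 * D / η) / η ^ 2⌉₊ + 1 : ℕ) : ℝ)) ≤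
      (exp 2 / η ^ 2 + 2 + 2 / η) * exp ((exp 2 / η ^ 2 + 2 + 2 / η) * D) := by
  have hle := (Nat.ceil_lt_add_one (a := exp (2 + 2 * D / η) / η ^ 2) (by positivity)).le
  have hc : 0 ≤ exp 2 / η ^ 2 := by positivity
  have hc2 : 0 ≤ 2 / η := by positivity
  have h1 : exp (2 * D / η) ≤ exp ((exp 2 / η ^ 2 + 2 + 2 / η) * D) := by
    rw [exp_le_exp, mul_div_right_comm]
    exact mul_le_mul_of_nonneg_right (by linarith) hD
  have h2 : 1 ≤ exp (2 * D / η) := one_le_exp (by positivity)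
  push_cast
  calc (⌈exp (2 + 2 * D / η) / η ^ 2⌉₊ : ℝ) + 1
      ≤ exp 2 / η ^ 2 * exp (2 * D / η) + 2 := by
        rw [exp_add] at hle ⊢
        linarith [mul_div_right_comm (exp 2) (exp (2 * D / η)) (η ^ 2)]
    _ ≤ (exp 2 / η ^ 2 + 2 + 2 / η) * exp (2 * D / η) := by nlinarith
    _ ≤ _ := mul_le_mul_of_nonneg_left h1 (by linarith)

end FiniteEntropy

/-! ### Assembly and choice of constants -/

open FiniteEntropy in
theorem theorem6p1 (ε r : ℝ) (hε : 0 < ε) (hr : 0 < r) :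
    ∃ c : ℝ, 0 < c ∧
      ∀ (A : Type u) [Fintype A] [DecidableEq A] [MeasurableSpace A] [DiscreteMeasurableSpace A]
        (n : ℕ), 0 < n →
      ∀ (μ : Measure (Fin n → A)) [IsProbabilityMeasure μ],
        ∃ (m : ℕ) (hm : 0 < m) (p : Fin m → ℝ) (μs : Fin m → Measure (Fin n → A)),
          (∀ j, 0 ≤ p j) ∧ ∑ j, p j = 1 ∧
          (∀ j, IsProbabilityMeasure (μs j)) ∧
          μ = ∑ j, ENNReal.ofReal (p j) • μs j ∧
          (m : ℝ) ≤ c * Real.exp (c * dualTotalCorrelation μ) ∧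
          p ⟨0, hm⟩ < ε ∧
          ∀ j : Fin m, j ≠ ⟨0, hm⟩ → TInequality normHamming (μs j) (r * n / 600) r := by
  -- The metric is at most one, so for r ≥ 1 no decomposition is needed and the exceptional first
  -- term gets weight zero.
  rcases le_total 1 r with hr1 | hr1
  · refine ⟨2, two_pos, fun A _ _ _ _ n hn μ _ => ⟨2, two_pos, ![0, 1], fun _ => μ, ?_, by simp,
      fun _ => inferInstance, by simp, ?_, by simpa using hε, fun _ _ =>
        tInequality_of_one_le (by positivity) hr1⟩⟩
    · intro j; fin_cases j <;> simp
    · have h := Real.one_le_exp (mul_nonneg zero_le_two (dualTotalCorrelation_nonneg μ))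
      push_cast
      linarith
  set δ : ℝ := r ^ 2 / 2 / (600 + r) with hδ
  have hδ0 : 0 < δ := by positivity
  -- With this choice the exceptional weight 2η(1 + 1/δ) equals ε/2.
  set η : ℝ := ε / (4 * (1 + 1 / δ)) with hη
  have hη0 : 0 < η := by positivity
  refine ⟨Real.exp 2 / η ^ 2 + 2 + 2 / η, by positivity, fun A _ _ _ _ n hn μ _ => ?_⟩
  set D := dualTotalCorrelation μ with hD
  have hD0 : 0 ≤ D := dualTotalCorrelation_nonneg μ
  obtain ⟨κ, _, p, q, hp, hp1, hq, hq1, hpq, hinfo, hAT⟩ :=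
    exists_tensorizing_mixture (w := fun x => μ.real {x}) (fun _ => measureReal_nonneg)
      (sum_measureReal μ)
  rw [← dualTotalCorrelation_eq] at hinfo
  obtain ⟨t, ν, ht, ht1, hν, hν1, htν, ht0, hνq⟩ := exists_short_mixture
    (fun _ => measureReal_nonneg) (sum_measureReal μ) hp hp1 hq hq1 hpq (by positivity) hinfo hη0
    hδ0 (Nat.le_ceil _)
  refine ⟨_, Nat.succ_pos _, t, fun j => ofWeights (ν j), ht, ht1, fun j =>
    isProbabilityMeasure_ofWeights (hν j) (hν1 j), ?_, ceil_exp_add_one_le hD0 hη0, ?_, fun j hj => ?_⟩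
  · refine Measure.ext_iff_singleton.2 fun x => ?_
    rw [Measure.finsetSum_apply, ← ofReal_measureReal, ← htν x,
      ENNReal.ofReal_sum_of_nonneg fun j _ => mul_nonneg (ht j) (hν j x)]
    refine Finset.sum_congr rfl fun j _ => ?_
    rw [Measure.smul_apply, ofWeights_singleton, smul_eq_mul, ENNReal.ofReal_mul (ht j)]
  · have e : 2 * η * (1 + 1 / δ) = ε / 2 := by
      rw [hη]; field_simp; norm_num
    have : t ⟨0, Nat.succ_pos _⟩ ≤ ε / 2 := e ▸ ht0
    linarith
  · obtain ⟨l, hl⟩ := hνq j hj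
    refine tInequality_of_tensorizing hn (hq l) (hq1 l) (hAT l) (hν j) (hν1 j) hδ0.le hr
      (by linarith) hl ?_
    rw [hδ, div_mul_cancel₀ _ (by positivity)]
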